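/- A \emph{$3$-pattern} is a set $F$ of unordered pairs of distinct elements of $\{1,2,3\}$, i.e. a labelled graph on $\{1,2,3\}$; let $\mathcal F$ be any set of $3$-patterns and let $H$ be a finite simple graph. Distinct vertices $v_1,v_2,v_3$ of $H$, in this order, \emph{induce} $F$ if for all distinct $i,j\in\{1,2,3\}$ one has $v_iv_j\in E(H)$ if and only if $\{i,j\}\in F$. A linear ordering $<$ of $V(H)$ is \emph{$\mathcal F$-free} if there are no vertices $v_1<v_2<v_3$ of $H$ that, in this order, induce a pattern in $\mathcal F$. The \emph{constraint digraph} $H^+$ of $H$ with respect to $\mathcal F$ has as vertices the ordered pairs $(x,y)\in V(H)\times V(H)$ with $x\neq y$; whenever distinct vertices $x,y,z$ of $H$, in this order, induce a pattern in $\mathcal F$, there is an arc from $(x,y)$ to $(z,y)$ and an arc from $(y,z)$ to $(y,x)$ (and there are no other arcs). A set $D$ of vertices of $H^+$ \emph{contains a circuit} if for some $n\ge 1$ there are vertices $x_0,x_1,\dots,x_n$ of $H$ such that all the pairs $(x_0,x_1),(x_1,x_2),\dots,(x_{n-1},x_n),(x_n,x_0)$ belong to $D$. \textbf{Theorem.}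 $H$ has an $\mathcal F$-free ordering if and only if no strong component of $H^+$ contains a circuit. -/

import Mathlib

namespace OrderedPattern

/-- A pattern of order `k`: a set of unordered pairs of distinct elements of a `k`-element
linearly ordered set, that is, a labelled graph. The labels are `0, …, k - 1`. -/
abbrev Pattern (k : ℕ) : Type := SimpleGraph (Fin k)

/-- The distinct vertices `v 0, …, v (k - 1)` of `H`, listed in this order, induce the pattern
`P`. -/
def Induces {V : Type*} (H : SimpleGraph V) {k : ℕ} (P : Pattern k) (v : Fin k → V) : Prop :=
  Function.Injective v ∧ ∀ i j : Fin k, H.Adj (v i) (v j) ↔ P.Adj i j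

/-- The pattern `P` occurs in `H` under the linear ordering `L` of the vertices. -/
def Occurs {V : Type*} (H : SimpleGraph V) (L : LinearOrder V) {k : ℕ} (P : Pattern k) : Prop :=
  ∃ v : Fin k → V, (∀ i j : Fin k, i < j → L.lt (v i) (v j)) ∧ Induces H P v

/-- The linear ordering `L` of the vertices of `H` is `𝓕`-free. -/
def IsFreeOrdering {V : Type*} (H : SimpleGraph V) {k : ℕ} (𝓕 : Set (Pattern k))
    (L : LinearOrder V) : Prop :=
  ∀ P ∈ 𝓕, ¬ Occurs H L P

/-- Ordered pairs of distinct elements. -/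
abbrev DistinctPair (V : Type*) : Type _ := {p : V × V // p.1 ≠ p.2}

/-- The constraint digraph: whenever `x, y, z`, in this order, induce a pattern in `𝓕`, there is
an arc from `(x, y)` to `(z, y)` and an arc from `(y, z)` to `(y, x)`. -/
def constraintDigraph {V : Type*} (H : SimpleGraph V) (𝓕 : Set (Pattern 3)) :
    Digraph (DistinctPair V) where
  Adj p q := ∃ x y z : V, (∃ P ∈ 𝓕, Induces H P ![x, y, z]) ∧
    ((p.1 = (x, y) ∧ q.1 = (z, y)) ∨ (p.1 = (y, z) ∧ q.1 = (y, x)))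

/-- `b` can be reached from `a` by a directed walk, possibly of length zero. -/
def Reachable {W : Type*} (G : Digraph W) (a b : W) : Prop :=
  Relation.ReflTransGen G.Adj a b

/-- `S` is (the vertex set of) a strong component of `G`: a class of mutually reachable
vertices. -/
def IsStrongComponent {W : Type*} (G : Digraph W) (S : Set W) : Prop :=
  ∃ a : W, S = {b : W | Reachable G a b ∧ Reachable G b a}

/-- The set `D` of pairs contains a circuit `(x₀, x₁), (x₁, x₂), …, (xₙ₋₁, xₙ), (xₙ, x₀)` with
`n ≥ 1`. The addition in `Fin (n + 1)` is cyclic. -/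
def HasCircuit {V : Type*} (D : Set (DistinctPair V)) : Prop :=
  ∃ n : ℕ, 1 ≤ n ∧ ∃ x : Fin (n + 1) → V,
    ∀ i : Fin (n + 1), ∃ h : x i ≠ x (i + 1), (⟨(x i, x (i + 1)), h⟩ : DistinctPair V) ∈ D

end OrderedPattern

namespace OrderedPattern

open Relation

/-! An arc from one pair to another is an implication: an `𝓕`-free order that is increasing on the
first pair is increasing on the second. Hence the pairs of a strong component are all increasing or
all decreasing, and a circuit among them would be a cyclic chain of inequalities. This gives
necessity.

For sufficiency, three vertices span a triangle, an independent set, an induced path, or an induced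
path of the complement. If a triangle or independent triple is forbidden in one order, it is
forbidden in all six, which yields a circuit (`NoCircuit.false_of_permutations`). What remains are
six flags: whether the centre of an induced path of `H`, or of `Hᶜ`, is forbidden to be first,
middle or last. If all three are set for one of the two graphs, it has no induced path at all
(`not_isP3_of_all`) and its flags can be dropped.

Complementation, reversal and monotonicity reduce the other combinations to fourteen cases of
`Solvable`. In each, the absence of circuits excludes small subgraphs or gives a transitive
orientation, and the resulting graph class has a suitable order. The substantial ones are chordal
graphs (`exists_avoids_first`), comparability graphs (`exists_isTransitiveOrientation`) and proper
interval graphs (`exists_avoids_first_last`); the others concern threshold, trivially perfect,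
split, permutation and interval graphs. -/

/-- The arcs of the constraint digraph of a ternary relation `F` of forbidden ordered triples. -/
def Arc {V : Type*} (F : V → V → V → Prop) (p q : V × V) : Prop :=
  ∃ x y z : V, F x y z ∧ ((p = (x, y) ∧ q = (z, y)) ∨ (p = (y, z) ∧ q = (y, x)))

/-- Reachability along the arcs of the constraint digraph. -/
def Reach {V : Type*} (F : V → V → V → Prop) : V × V → V × V → Prop :=
  ReflTransGen (Arc F)

/-- Mutual reachability in the constraint digraph. -/
def Linked {V : Type*} (F : V → V → V → Prop) (p q : V × V) : Prop :=
  Reach F p q ∧ Reach F q p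

/-- No class of mutually reachable pairs contains a circuit. -/
def NoCircuit {V : Type*} (F : V → V → V → Prop) : Prop :=
  ∀ (p : V × V) (v : V), ¬ TransGen (fun x y => x ≠ y ∧ Linked F p (x, y)) v v

/-- `x`, `c`, `z` induce a path on three vertices with centre `c`. -/
def IsP3 {V : Type*} (G : SimpleGraph V) (c x z : V) : Prop :=
  G.Adj c x ∧ G.Adj c z ∧ ¬ G.Adj x z ∧ x ≠ z

/-! ### Implications between pairs and their symmetries -/

section Reach

variable {V : Type*} {F : V → V → V → Prop}

theorem Reach.left {x y z : V} (h : F x y z) : Reach F (x, y) (z, y) :=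
  .single ⟨x, y, z, h, .inl ⟨rfl, rfl⟩⟩

theorem Reach.right {x y z : V} (h : F x y z) : Reach F (y, z) (y, x) :=
  .single ⟨x, y, z, h, .inr ⟨rfl, rfl⟩⟩

/-- The two arcs of a forbidden triple are contrapositives of each other. -/
theorem Reach.swap {p q : V × V} (h : Reach F p q) : Reach F q.swap p.swap := by
  induction h with
  | refl => exact .refl
  | tail _ h ih =>
    refine ReflTransGen.head ?_ ih
    obtain ⟨x, y, z, hF, ⟨rfl, rfl⟩ | ⟨rfl, rfl⟩⟩ := h
    · exact ⟨x, y, z, hF, .inr ⟨rfl, rfl⟩⟩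
    · exact ⟨x, y, z, hF, .inl ⟨rfl, rfl⟩⟩

theorem Linked.refl (p : V × V) : Linked F p p := ⟨.refl, .refl⟩

theorem Linked.symm {p q : V × V} (h : Linked F p q) : Linked F q p := ⟨h.2, h.1⟩

theorem Linked.trans {p q r : V × V} (h : Linked F p q) (h' : Linked F q r) : Linked F p r :=
  ⟨h.1.trans h'.1, h'.2.trans h.2⟩

theorem Linked.swap {p q : V × V} (h : Linked F p q) : Linked F p.swap q.swap :=
  ⟨h.2.swap, h.1.swap⟩

theorem Arc.flip {p q : V × V} (h : Arc (fun x y z => F z y x) p q) : Arc F q p := by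
  obtain ⟨x, y, z, hF, ⟨rfl, rfl⟩ | ⟨rfl, rfl⟩⟩ := h
  · exact ⟨z, y, x, hF, .inl ⟨rfl, rfl⟩⟩
  · exact ⟨z, y, x, hF, .inr ⟨rfl, rfl⟩⟩

theorem Reach.flip {p q : V × V} (h : Reach (fun x y z => F z y x) p q) : Reach F q p := by
  induction h with
  | refl => exact .refl
  | tail _ h ih => exact ReflTransGen.head h.flip ih

/-- Reversing all forbidden triples reverses all arcs, so mutual reachability is unchanged. Thus
results on centres placed first also serve for centres placed last. -/
theorem NoCircuit.flip (h : NoCircuit F) : NoCircuit (fun x y z => F z y x) := by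
  intro p v hv
  refine h p v (TransGen.mono (fun x y hxy => ?_) v v hv)
  exact ⟨hxy.1, hxy.2.2.flip, hxy.2.1.flip⟩

theorem NoCircuit.not_linked_swap (h : NoCircuit F) {x y : V} (hne : x ≠ y) :
    ¬ Linked F (x, y) (y, x) := fun hl =>
  h (x, y) x (.head ⟨hne, .refl _⟩ (.single ⟨hne.symm, hl⟩))

end Reach

/-! ### Induced paths on three vertices -/

section P3

variable {V : Type*} {G : SimpleGraph V} {c x z : V}

theorem IsP3.symm (h : IsP3 G c x z) : IsP3 G c z x :=
  ⟨h.2.1, h.1, fun h' => h.2.2.1 h'.symm, h.2.2.2.symm⟩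

theorem isP3_compl_iff : IsP3 Gᶜ c x z ↔ ¬ G.Adj c x ∧ ¬ G.Adj c z ∧ G.Adj x z ∧ c ≠ x ∧ c ≠ z := by
  unfold IsP3
  simp only [SimpleGraph.compl_adj]
  constructor
  · rintro ⟨⟨h1, h2⟩, ⟨h3, h4⟩, h5, h6⟩
    refine ⟨h2, h4, ?_, h1, h3⟩
    by_contra h
    exact h5 ⟨h6, h⟩
  · rintro ⟨h1, h2, h3, h4, h5⟩
    exact ⟨⟨h4, h1⟩, ⟨h5, h2⟩, fun h => h.2 h3, h3.ne⟩

end P3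

/-! ### Construction of linear orders -/

section Order

variable {V : Type*}

/-- Every acyclic relation is contained in a strict linear order. -/
theorem exists_linearOrder_of_acyclic (r : V → V → Prop) (hr : ∀ v, ¬ TransGen r v v) :
    ∃ L : LinearOrder V, ∀ x y, r x y → L.lt x y := by
  classical
  have : IsPartialOrder V (ReflTransGen r) :=
    { refl := fun _ => .refl
      trans := fun _ _ _ => ReflTransGen.trans
      antisymm := by
        intro a b hab hba
        by_contra hne
        rcases reflTransGen_iff_eq_or_transGen.1 hab with h | h
        · exact hne h.symm
        · exact hr a (h.trans_left hba) }
  obtain ⟨s, hs, hle⟩ := extend_partialOrder (ReflTransGen r)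
  refine ⟨{ le := s
            le_refl := hs.refl
            le_trans := hs.trans
            le_antisymm := hs.antisymm
            le_total := hs.total
            toDecidableLE := Classical.decRel _ }, fun x y hxy => ?_⟩
  refine ⟨hle x y (.single hxy), fun hyx => ?_⟩
  have : x = y := hs.antisymm _ _ (hle x y (.single hxy)) hyx
  subst this
  exact hr x (.single hxy)

/-- Vertices can be sorted by any key. -/
theorem exists_linearOrder_of_key {α : Type*} [LinearOrder α] (f : V → α) :
    ∃ L : LinearOrder V, ∀ x y, L.lt x y → f x ≤ f y := by
  obtain ⟨L, hL⟩ := exists_linearOrder_of_acyclic (fun x y => f x < f y) (by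
    intro v hv
    have : ∀ x y, TransGen (fun x y => f x < f y) x y → f x < f y := by
      intro x y h
      induction h with
      | single h => exact h
      | tail _ h ih => exact ih.trans h
    exact lt_irrefl _ (this v v hv))
  refine ⟨L, fun x y hxy => ?_⟩
  by_contra h
  exact lt_asymm hxy (hL y x (not_le.1 h))

/-- Elimination orders: if every nonempty set of vertices has an element that is admissible as
its first element, then the vertices have an ordering in which every vertex is admissible as the
first element of the set of its successors. -/
theorem exists_linearOrder_of_elimination [Finite V] (good : Set V → V → Prop)
    (h : ∀ W : Set V, W.Nonempty → ∃ s ∈ W, good W s) :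
    ∃ L : LinearOrder V, ∀ s, ∃ W, good W s ∧ ∀ x, L.le s x → x ∈ W := by
  have key : ∀ n : ℕ, ∀ W : Set V, W.ncard = n → ∃ f : V → ℕ,
      (∀ s ∈ W, ∃ W', good W' s ∧ ∀ x ∈ W, f s ≤ f x → x ∈ W') ∧
        ∀ x ∈ W, ∀ y ∈ W, f x = f y → x = y := by
    intro n
    induction n with
    | zero =>
      intro W hW
      have : W = ∅ := by rwa [Set.ncard_eq_zero] at hW
      subst this
      exact ⟨fun _ => 0, by simp, by simp⟩
    | succ n ih =>
      intro W hW
      obtain ⟨s, hs, hgood⟩ := h W (by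
        rw [← Set.ncard_pos]; omega)
      obtain ⟨f, hf, hinj⟩ := ih (W \ {s}) (by
        rw [Set.ncard_sdiff_singleton_of_mem hs]; omega)
      classical
      -- The eliminated vertex `s` gets rank zero and all other ranks move up by one.
      refine ⟨fun x => if x = s then 0 else f x + 1, ?_, ?_⟩
      · intro t ht
        by_cases hts : t = s
        · subst hts
          exact ⟨W, hgood, fun x hx _ => hx⟩
        · obtain ⟨W', hW', hx⟩ := hf t ⟨ht, hts⟩
          refine ⟨W', hW', fun x hxW hle => ?_⟩
          by_cases hxs : x = s
          · simp [hts, hxs] at hle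
          · refine hx x ⟨hxW, hxs⟩ ?_
            simpa [hts, hxs] using hle
      · intro x hx y hy hxy
        by_cases hxs : x = s <;> by_cases hys : y = s <;> simp [hxs, hys] at hxy ⊢
        exact hinj x ⟨hx, hxs⟩ y ⟨hy, hys⟩ hxy
  obtain ⟨f, hf, hinj⟩ := key _ Set.univ rfl
  have hinj' : Function.Injective f := fun x y hxy => hinj x trivial y trivial hxy
  refine ⟨LinearOrder.lift' f hinj', fun s => ?_⟩
  obtain ⟨W', hW', hx⟩ := hf s trivial
  exact ⟨W', hW', fun x hle => hx x trivial hle⟩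

end Order

/-! ### Small subgraphs excluded by the absence of circuits -/

section Configurations

variable {V : Type*}

/-- `G` has no induced cycle `a c b d` on four vertices. -/
def SquareFree (G : SimpleGraph V) : Prop :=
  ∀ ⦃a b c d : V⦄, G.Adj a c → G.Adj c b → G.Adj b d → G.Adj d a → ¬ G.Adj a b → a ≠ b →
    ¬ G.Adj c d → c ≠ d → False

/-- `G` has no induced path on four vertices. -/
def PathFree (G : SimpleGraph V) : Prop :=
  ∀ ⦃a b c d : V⦄, G.Adj a b → G.Adj b c → G.Adj c d → ¬ G.Adj a c → a ≠ c → ¬ G.Adj b d →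
    b ≠ d → ¬ G.Adj a d → False

/-- `G` has no alternating four-cycle. -/
def AlternatingFree (G : SimpleGraph V) : Prop :=
  ∀ ⦃a b c d : V⦄, G.Adj a b → G.Adj c d → ¬ G.Adj a c → a ≠ c → ¬ G.Adj b d → b ≠ d → False

/-- `G` has no induced claw. -/
def ClawFree (G : SimpleGraph V) : Prop :=
  ∀ ⦃c x y z : V⦄, IsP3 G c x y → IsP3 G c y z → IsP3 G c x z → False

/-- No two vertices are the centre and an end of two induced paths in opposite roles. -/
def NestedNeighborhoods (G : SimpleGraph V) : Prop :=
  ∀ ⦃u v a b : V⦄, IsP3 G u a v → IsP3 G v b u → False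

variable {G : SimpleGraph V} {F : V → V → V → Prop}

/-- These are the threshold graphs. The pairs `a d` and `b c` decide whether an alternating cycle
spans a square, a path, or two disjoint edges, the last being a square of the complement. -/
theorem alternatingFree_of (h₁ : SquareFree G) (h₂ : SquareFree Gᶜ) (h₃ : PathFree G) :
    AlternatingFree G := by
  intro a b c d hab hcd hac hac' hbd hbd'
  by_cases had : G.Adj a d <;> by_cases hbc : G.Adj b c
  · exact h₁ hab hbc hcd had.symm hac hac' hbd hbd'
  · exact h₃ hab.symm had hcd.symm hbd hbd' hac hac' hbc
  · exact h₃ hab hbc hcd hac hac' hbd hbd' had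
  · have had' : a ≠ d := by rintro rfl; exact hac hcd.symm
    have hbc' : b ≠ c := by rintro rfl; exact hac hab
    refine h₂ (a := a) (b := b) (c := c) (d := d) ?_ ?_ ?_ ?_ ?_ hab.ne ?_ hcd.ne
    · exact ⟨hac', hac⟩
    · exact ⟨hbc'.symm, fun h => hbc h.symm⟩
    · exact ⟨hbd', hbd⟩
    · exact ⟨had'.symm, fun h => had h.symm⟩
    · exact fun h => h.2 hab
    · exact fun h => h.2 hcd

theorem AlternatingFree.compl (h : AlternatingFree G) : AlternatingFree Gᶜ := by
  intro a b c d hab hcd hac hac' hbd hbd'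
  have h1 : G.Adj a c := by
    by_contra h; exact hac ⟨hac', h⟩
  have h2 : G.Adj b d := by
    by_contra h; exact hbd ⟨hbd', h⟩
  exact h h1 h2 hab.2 hab.1 hcd.2 hcd.1

/-- Paths centred at `c`, `a` and `d` lead from the diagonal `(a, b)` to `(b, a)`; exchanging `a`
and `b` leads back. -/
theorem squareFree_of_first (hF : NoCircuit F) (h : ∀ c x z, IsP3 G c x z → F c x z) :
    SquareFree G := by
  have key : ∀ a b c d, G.Adj a c → G.Adj c b → G.Adj b d → G.Adj d a → ¬ G.Adj a b → a ≠ b →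
      ¬ G.Adj c d → c ≠ d → Reach F (a, b) (b, a) := by
    intro a b c d hac hcb hbd hda hab hab' hcd hcd'
    have e1 : F c a b := h c a b ⟨hac.symm, hcb, hab, hab'⟩
    have e2 : F a c d := h a c d ⟨hac, hda.symm, hcd, hcd'⟩
    have e3 : F a d c := h a d c ⟨hda.symm, hac, fun h => hcd h.symm, hcd'.symm⟩
    have e4 : F d a b := h d a b ⟨hda, hbd.symm, hab, hab'⟩
    exact (Reach.right e1).trans ((Reach.left e2).trans ((Reach.right e3).trans (Reach.left e4)))
  intro a b c d hac hcb hbd hda hab hab' hcd hcd'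
  refine hF.not_linked_swap hab' ⟨key a b c d hac hcb hbd hda hab hab' hcd hcd', ?_⟩
  exact key b a c d hcb.symm hac.symm hda.symm hbd.symm (fun h => hab h.symm) hab'.symm hcd hcd'

theorem squareFree_of_last (hF : NoCircuit F) (h : ∀ c x z, IsP3 G c x z → F x z c) :
    SquareFree G :=
  squareFree_of_first hF.flip fun c x z hP => h c z x hP.symm

/-- The two paths of `G` inside `a b c d`, together with the paths of the complement centred at `a`
and `d`, link `(a, b)` with `(b, a)`. -/
theorem pathFree_of_first_of_first (hF : NoCircuit F) (hA : ∀ c x z, IsP3 Gᶜ c x z → F c x z)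
    (hB : ∀ c x z, IsP3 G c x z → F c x z) : PathFree G := by
  intro a b c d hab hbc hcd hac hac' hbd hbd' had
  have had' : a ≠ d := by rintro rfl; exact hac hcd.symm
  have d_ab : F d a b := hA _ _ _ (isP3_compl_iff.2
    ⟨fun h => had h.symm, fun h => hbd h.symm, hab, had'.symm, hbd'.symm⟩)
  have d_ba : F d b a := hA _ _ _ (isP3_compl_iff.2
    ⟨fun h => hbd h.symm, fun h => had h.symm, hab.symm, hbd'.symm, had'.symm⟩)
  have a_cd : F a c d := hA _ _ _ (isP3_compl_iff.2 ⟨hac, had, hcd, hac', had'⟩)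
  have a_dc : F a d c := hA _ _ _ (isP3_compl_iff.2 ⟨had, hac, hcd.symm, had', hac'⟩)
  have b_ac : F b a c := hB _ _ _ ⟨hab.symm, hbc, hac, hac'⟩
  have b_ca : F b c a := hB _ _ _ ⟨hbc, hab.symm, fun h => hac h.symm, hac'.symm⟩
  have c_bd : F c b d := hB _ _ _ ⟨hbc.symm, hcd, hbd, hbd'⟩
  have c_db : F c d b := hB _ _ _ ⟨hcd, hbc.symm, fun h => hbd h.symm, hbd'.symm⟩
  have e : Reach F (b, d) (a, c) :=
    (Reach.right c_bd).trans (Reach.left b_ca)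
  refine hF.not_linked_swap hab.ne ⟨?_, ?_⟩
  · exact (Reach.right d_ab).trans ((Reach.left a_dc).trans ((Reach.left c_db).trans (e.trans
      ((Reach.left a_cd).trans ((Reach.right a_dc).trans (Reach.left d_ab))))))
  · exact (Reach.right d_ba).trans (e.trans (Reach.right b_ac))

theorem alternatingFree_of_first_of_first (hF : NoCircuit F)
    (hA : ∀ c x z, IsP3 Gᶜ c x z → F c x z) (hB : ∀ c x z, IsP3 G c x z → F c x z) :
    AlternatingFree G :=
  alternatingFree_of (squareFree_of_first hF hB) (squareFree_of_first hF hA)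
    (pathFree_of_first_of_first hF hA hB)

/-- If `u` is the centre and `v` an end, then `v` before `u` implies `u` before `v`. With both roles
present, the implications run both ways. -/
theorem nestedNeighborhoods_of_mid_of_last (hF : NoCircuit F)
    (hm : ∀ c x z, IsP3 G c x z → F x c z) (hl : ∀ c x z, IsP3 G c x z → F x z c) :
    NestedNeighborhoods G := by
  have key : ∀ u v a, IsP3 G u a v → Reach F (v, u) (u, v) := fun u v a h =>
    (Reach.right (hl u a v h)).trans ((Reach.left (hl u v a h.symm)).trans
      (Reach.right (hm u v a h.symm)))
  intro u v a b h1 h2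
  exact hF.not_linked_swap h1.2.1.ne ⟨key v u b h2, key u v a h1⟩

theorem NestedNeighborhoods.squareFree (h : NestedNeighborhoods G) : SquareFree G := by
  intro a b c d hac hcb hbd hda hab hab' hcd hcd'
  exact h (u := a) (v := c) (a := d) (b := b) ⟨hda.symm, hac, fun h => hcd h.symm, hcd'.symm⟩
    ⟨hcb, hac.symm, fun h => hab h.symm, hab'.symm⟩

theorem NestedNeighborhoods.pathFree (h : NestedNeighborhoods G) : PathFree G := by
  intro a b c d hab hbc hcd hac hac' hbd hbd' _
  exact h (u := b) (v := c) ⟨hab.symm, hbc, hac, hac'⟩ ⟨hcd, hbc.symm, fun h => hbd h.symm, hbd'.symm⟩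

/-- The centre has to lie between the ends, so the three pairs along the path are equivalent. -/
theorem linked_of_isP3 (hf : ∀ c x z, IsP3 G c x z → F c x z)
    (hl : ∀ c x z, IsP3 G c x z → F x z c) {c x z : V} (h : IsP3 G c x z) :
    Linked F (x, c) (x, z) ∧ Linked F (x, z) (c, z) ∧ Linked F (x, c) (c, z) := by
  have h1 : Linked F (x, c) (x, z) := ⟨.right (hl c z x h.symm), .right (hf c x z h)⟩
  have h2 : Linked F (x, z) (c, z) := ⟨.left (hl c x z h), .left (hf c z x h.symm)⟩
  exact ⟨h1, h2, h1.trans h2⟩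

/-- The centre would have to separate each two of three leaves, but has only two sides. -/
theorem clawFree_of_first_of_last (hF : NoCircuit F) (hf : ∀ c x z, IsP3 G c x z → F c x z)
    (hl : ∀ c x z, IsP3 G c x z → F x z c) : ClawFree G := by
  intro c x y z h1 h2 h3
  have e1 := (linked_of_isP3 hf hl h1).2.2
  have e2 := (linked_of_isP3 hf hl h2).2.2
  have e3 := (linked_of_isP3 hf hl h3).2.2
  exact hF.not_linked_swap h1.2.1.ne (e1.symm.trans (e3.trans e2.symm))

theorem not_isP3_of_all (hF : NoCircuit F) (hf : ∀ c x z, IsP3 G c x z → F c x z)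
    (hm : ∀ c x z, IsP3 G c x z → F x c z) (hl : ∀ c x z, IsP3 G c x z → F x z c) (c x z : V) :
    ¬ IsP3 G c x z := by
  intro h
  have e1 := (linked_of_isP3 hf hl h).2.2
  have e2 : Linked F (x, c) (z, c) := ⟨.left (hm c x z h), .left (hm c z x h.symm)⟩
  exact hF.not_linked_swap h.2.1.ne (e1.symm.trans e2)

end Configurations

/-! ### Comparison of degrees -/

section Degrees

variable {V : Type*} [Finite V] {G : SimpleGraph V}

theorem exists_adj_of_ncard_neighborSet_le {x y w : V}
    (h : (G.neighborSet x).ncard ≤ (G.neighborSet y).ncard) (hw : G.Adj x w) (hw' : ¬ G.Adj y w) :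
    ∃ p, G.Adj y p ∧ ¬ G.Adj x p := by
  by_contra hcon
  push Not at hcon
  have : (G.neighborSet y).ncard < (G.neighborSet x).ncard :=
    Set.ncard_lt_ncard ⟨fun p hp => hcon p hp, fun hs => hw' (hs hw)⟩ (Set.toFinite _)
  omega

theorem ncard_insert_neighborSet (x : V) :
    (insert x (G.neighborSet x)).ncard = (G.neighborSet x).ncard + 1 :=
  Set.ncard_insert_of_notMem (by simp) (Set.toFinite _)

/-- Comparing closed neighbourhoods, which both contain `x` and `y`, keeps `x` from being the vertex
found. -/
theorem exists_adj_of_adj_of_ncard_neighborSet_le {x y w : V}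
    (h : (G.neighborSet x).ncard ≤ (G.neighborSet y).ncard) (hxy : G.Adj x y) (hw : G.Adj x w)
    (hw' : ¬ G.Adj y w) (hne : w ≠ y) : ∃ p, G.Adj y p ∧ ¬ G.Adj x p ∧ p ≠ x := by
  by_contra hcon
  push Not at hcon
  have : (insert y (G.neighborSet y)).ncard < (insert x (G.neighborSet x)).ncard := by
    refine Set.ncard_lt_ncard ⟨?_, fun hs => ?_⟩ (Set.toFinite _)
    · rintro p (rfl | hp)
      · exact .inr hxy
      · by_cases hxp : G.Adj x p
        · exact .inr hxp
        · exact .inl (hcon p hp hxp)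
    · rcases hs (.inr hw) with h' | h'
      · exact hne h'
      · exact hw' h'
  rw [ncard_insert_neighborSet, ncard_insert_neighborSet] at this
  omega

/-- Otherwise `x` has a neighbour that `c` lacks and becomes the centre of a path with end `c`. -/
theorem NestedNeighborhoods.ncard_lt (h : NestedNeighborhoods G) {c x z : V}
    (hP : IsP3 G c x z) : (G.neighborSet x).ncard < (G.neighborSet c).ncard := by
  by_contra hle
  obtain ⟨p, h1, h2, h3⟩ := exists_adj_of_adj_of_ncard_neighborSet_le (not_lt.1 hle) hP.1 hP.2.1
    hP.2.2.1 hP.2.2.2.symm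
  exact h hP.symm ⟨h1, hP.1.symm, fun h' => h2 h'.symm, h3⟩

end Degrees

/-- The order `L` avoids the induced paths on three vertices whose centre is first, in the middle,
or last, as selected by the three flags. -/
structure Avoids {V : Type*} (L : LinearOrder V) (G : SimpleGraph V) (s : Bool × Bool × Bool) :
    Prop where
  first : s.1 = true → ∀ c x z, IsP3 G c x z → L.lt c x → L.lt x z → False
  mid : s.2.1 = true → ∀ c x z, IsP3 G c x z → L.lt x c → L.lt c z → False
  last : s.2.2 = true → ∀ c x z, IsP3 G c x z → L.lt x z → L.lt z c → False

/-- The triples `F` contain all induced paths on three vertices whose centre is first, in the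
middle, or last, as selected by the three flags. -/
structure Forces {V : Type*} (F : V → V → V → Prop) (G : SimpleGraph V) (s : Bool × Bool × Bool) :
    Prop where
  first : s.1 = true → ∀ c x z, IsP3 G c x z → F c x z
  mid : s.2.1 = true → ∀ c x z, IsP3 G c x z → F x c z
  last : s.2.2 = true → ∀ c x z, IsP3 G c x z → F x z c

/-! ### Threshold and split graphs: orders from degrees -/

section SortingOrders

variable {V : Type*} {G : SimpleGraph V} {F : V → V → V → Prop}

theorem SquareFree.not_two_edges (h : SquareFree Gᶜ) {a b c d : V} (hab : G.Adj a b)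
    (hcd : G.Adj c d) (hac : ¬ G.Adj a c) (had : ¬ G.Adj a d) (hbc : ¬ G.Adj b c)
    (hbd : ¬ G.Adj b d) : False := by
  have hac' : a ≠ c := by rintro rfl; exact had hcd
  have had' : a ≠ d := by rintro rfl; exact hac hcd.symm
  have hbc' : b ≠ c := by rintro rfl; exact hac hab
  have hbd' : b ≠ d := by rintro rfl; exact had hab
  refine h (a := a) (b := b) (c := c) (d := d) ⟨hac', hac⟩ ⟨hbc'.symm, fun h => hbc h.symm⟩
    ⟨hbd', hbd⟩ ⟨had'.symm, fun h => had h.symm⟩ (fun h => h.2 hab) hab.ne (fun h => h.2 hcd) hcd.ne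

theorem AlternatingFree.nestedNeighborhoods (h : AlternatingFree G) : NestedNeighborhoods G :=
  fun _ _ _ _ h1 h2 => h h1.1.symm h2.1 h1.2.2.1 h1.2.2.2 (fun h' => h2.2.2.1 h'.symm)
    h2.2.2.2.symm

theorem exists_avoids_mid_last [Finite V] (h : NestedNeighborhoods G) :
    ∃ L : LinearOrder V, Avoids L G (false, true, true) := by
  obtain ⟨L, hL⟩ := exists_linearOrder_of_key
    (fun v => OrderDual.toDual (G.neighborSet v).ncard)
  have hL' : ∀ x y, L.lt x y → (G.neighborSet y).ncard ≤ (G.neighborSet x).ncard := hL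
  refine ⟨L, by simp, fun _ c x z hP h1 h2 => ?_, fun _ c x z hP h1 h2 => ?_⟩
  · have := h.ncard_lt hP
    have := hL' _ _ h1
    omega
  · have := h.ncard_lt hP
    have := hL' _ _ h1
    have := hL' _ _ h2
    omega

/-- Centres of paths have larger degree than the ends; for paths of the complement it is smaller.
Decreasing degree therefore puts the former first and the latter last. -/
theorem AlternatingFree.exists_avoids_first_mid_and_mid_last [Finite V] (h : AlternatingFree G) :
    ∃ L : LinearOrder V, Avoids L Gᶜ (true, true, false) ∧ Avoids L G (false, true, true) := by
  obtain ⟨L, hL⟩ := exists_linearOrder_of_key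
    (fun v => OrderDual.toDual (G.neighborSet v).ncard)
  have hL' : ∀ x y, L.lt x y → (G.neighborSet y).ncard ≤ (G.neighborSet x).ncard := hL
  have hdeg : ∀ c x z, IsP3 Gᶜ c x z → (G.neighborSet c).ncard < (G.neighborSet x).ncard := by
    intro c x z hP
    obtain ⟨h1, h2, h3, h4, h5⟩ := isP3_compl_iff.1 hP
    by_contra hle
    obtain ⟨p, h6, h7⟩ := exists_adj_of_ncard_neighborSet_le (not_lt.1 hle) h3 h2
    refine h h6 h3.symm h2 h5 (fun h' => h7 h'.symm) ?_
    rintro rfl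
    exact h1 h6
  refine ⟨L, ⟨fun _ c x z hP h1 h2 => ?_, fun _ c x z hP h1 h2 => ?_, by simp⟩,
    by simp, fun _ c x z hP h1 h2 => ?_, fun _ c x z hP h1 h2 => ?_⟩
  · have := hdeg _ _ _ hP
    have := hL' _ _ h1
    omega
  · have := hdeg _ _ _ hP.symm
    have := hL' _ _ h2
    omega
  · have := h.nestedNeighborhoods.ncard_lt hP
    have := hL' _ _ h1
    omega
  · have := h.nestedNeighborhoods.ncard_lt hP
    have := hL' _ _ h1
    have := hL' _ _ h2
    omega

/-- Let `u` have largest degree within `W` and let `w` be a nonneighbour. A neighbour `p` of `w`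
would be adjacent to every other neighbour of `u`, and to `w` as well, so its degree would be
larger; hence `w` is isolated in `W`. -/
theorem AlternatingFree.exists_dominating_or_isolated [Finite V] (h : AlternatingFree G)
    (W : Set V) (hW : W.Nonempty) :
    ∃ s ∈ W, (∀ x ∈ W, x ≠ s → G.Adj s x) ∨ ∀ x ∈ W, ¬ G.Adj s x := by
  obtain ⟨u, hu, hmax⟩ := Set.exists_max_image W (fun x => (G.neighborSet x ∩ W).ncard)
    (Set.toFinite _) hW
  by_cases hdom : ∀ x ∈ W, x ≠ u → G.Adj u x
  · exact ⟨u, hu, .inl hdom⟩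
  push Not at hdom
  obtain ⟨w, hw, hwu, huw⟩ := hdom
  refine ⟨w, hw, .inr fun p hp hwp => ?_⟩
  have hsub : ∀ q, G.Adj u q → q ≠ p → G.Adj p q := by
    intro q hq hqp
    by_contra hcon
    exact h hq hwp huw hwu.symm (fun h' => hcon h'.symm) hqp
  have hle := hmax p hp
  have hpu : p ≠ u := by rintro rfl; exact huw hwp.symm
  by_cases hup : G.Adj u p
  · have : (insert u (G.neighborSet u ∩ W)).ncard < (insert p (G.neighborSet p ∩ W)).ncard := by
      refine Set.ncard_lt_ncard ⟨?_, fun hs => ?_⟩ (Set.toFinite _)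
      · rintro q (rfl | ⟨hq, hqW⟩)
        · exact .inr ⟨hup.symm, hu⟩
        · by_cases hqp : q = p
          · exact .inl hqp
          · exact .inr ⟨hsub q hq hqp, hqW⟩
      · rcases hs (.inr ⟨hwp.symm, hw⟩) with h' | h'
        · exact hwu h'
        · exact huw h'.1
    rw [Set.ncard_insert_of_notMem (by simp) (Set.toFinite _),
      Set.ncard_insert_of_notMem (by simp) (Set.toFinite _)] at this
    omega
  · have : (G.neighborSet u ∩ W).ncard < (G.neighborSet p ∩ W).ncard := by
      refine Set.ncard_lt_ncard ⟨?_, fun hs => ?_⟩ (Set.toFinite _)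
      · rintro q ⟨hq, hqW⟩
        exact ⟨hsub q hq (by rintro rfl; exact hup hq), hqW⟩
      · exact huw (hs ⟨hwp.symm, hw⟩).1
    omega

theorem AlternatingFree.exists_avoids_mid_last [Finite V] (h : AlternatingFree G) :
    ∃ L : LinearOrder V, Avoids L Gᶜ (false, true, true) ∧ Avoids L G (false, true, true) := by
  obtain ⟨L, hL⟩ := exists_linearOrder_of_elimination
    (fun W s => (∀ x ∈ W, x ≠ s → G.Adj s x) ∨ ∀ x ∈ W, ¬ G.Adj s x)
    h.exists_dominating_or_isolated
  -- The earliest of three vertices is adjacent to both others or to neither, a condition invariant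
  -- under complementation.
  have key : ∀ a b c, L.lt a b → L.lt a c → G.Adj a b → ¬ G.Adj a c → False := by
    intro a b c hab hac h1 h2
    obtain ⟨W, hW | hW, hx⟩ := hL a
    · exact h2 (hW c (hx c hac.le) hac.ne')
    · exact hW b (hx b hab.le) h1
  refine ⟨L, ⟨by simp, fun _ c x z hP h1 h2 => ?_, fun _ c x z hP h1 h2 => ?_⟩,
    by simp, fun _ c x z hP h1 h2 => ?_, fun _ c x z hP h1 h2 => ?_⟩
  · obtain ⟨h3, h4, h5, -⟩ := isP3_compl_iff.1 hP
    exact key x z c (h1.trans h2) h1 h5 fun h => h3 h.symm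
  · obtain ⟨h3, h4, h5, -⟩ := isP3_compl_iff.1 hP
    exact key x z c h1 (h1.trans h2) h5 fun h => h3 h.symm
  · exact key x c z h1 (h1.trans h2) hP.1.symm hP.2.2.1
  · exact key x c z (h1.trans h2) h1 hP.1.symm hP.2.2.1

/-- `G` has no induced cycle on five vertices. -/
def PentagonFree (G : SimpleGraph V) : Prop :=
  ∀ ⦃a b c d e : V⦄, G.Adj a b → G.Adj b c → G.Adj c d → G.Adj d e → G.Adj e a →
    ¬ G.Adj a c → ¬ G.Adj a d → ¬ G.Adj b d → ¬ G.Adj b e → ¬ G.Adj c e → False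

/-- Decreasing degree works. If a nonneighbour `x` of `y` precedes an edge `y z`, degree comparisons
give further neighbours `p` of `x` and `q` of `y`, and these complete a square, two disjoint edges
or a pentagon. -/
theorem exists_avoids_split [Finite V] (h₁ : SquareFree G) (h₂ : SquareFree Gᶜ)
    (h₃ : PentagonFree G) :
    ∃ L : LinearOrder V, Avoids L Gᶜ (true, false, false) ∧ Avoids L G (false, false, true) := by
  obtain ⟨L, hL⟩ := exists_linearOrder_of_key
    (fun v => OrderDual.toDual (G.neighborSet v).ncard)
  have hL' : ∀ x y, L.lt x y → (G.neighborSet y).ncard ≤ (G.neighborSet x).ncard := hL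
  have key : ∀ x y z, L.lt x y → L.lt y z → G.Adj y z → ¬ G.Adj x y → False := by
    intro x y z hxy hyz h_yz h_xy
    have hne := hxy.ne
    by_cases hxz : G.Adj x z
    · obtain ⟨q, hyq, hzq, hqz⟩ := exists_adj_of_adj_of_ncard_neighborSet_le (hL' _ _ hyz)
        h_yz.symm hxz.symm (fun h => h_xy h.symm) hne
      have hxq : ¬ G.Adj x q := fun hxq =>
        h₁ hxq hyq.symm h_yz hxz.symm h_xy hne (fun h => hzq h.symm) hqz
      obtain ⟨p, hxp, hyp⟩ := exists_adj_of_ncard_neighborSet_le (hL' _ _ hxy) hyq hxq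
      have hqp : G.Adj q p := by
        by_contra hqp
        exact h₂.not_two_edges hxp hyq h_xy hxq (fun h => hyp h.symm) (fun h => hqp h.symm)
      by_cases hpz : G.Adj p z
      · exact h₁ hpz h_yz.symm hyq hqp (fun h => hyp h.symm)
          (by rintro rfl; exact h_xy hxp) hzq hqz.symm
      · exact h₃ hxp.symm hxz h_yz.symm hyq hqp hpz (fun h => hyp h.symm) h_xy hxq hzq
    · obtain ⟨p, hxp, hyp⟩ := exists_adj_of_ncard_neighborSet_le (hL' _ _ hxy) h_yz hxz
      have hpy : p ≠ y := by rintro rfl; exact h_xy hxp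
      have hpz : G.Adj p z := by
        by_contra hpz
        exact h₂.not_two_edges hxp h_yz h_xy hxz (fun h => hyp h.symm) hpz
      obtain ⟨q, hyq, hzq, hqz⟩ := exists_adj_of_adj_of_ncard_neighborSet_le (hL' _ _ hyz)
        h_yz.symm hpz.symm hyp hpy
      have hqp : ¬ G.Adj q p := fun hqp =>
        h₁ hpz h_yz.symm hyq hqp (fun h => hyp h.symm) hpy hzq hqz.symm
      have hxq : G.Adj x q := by
        by_contra hxq
        exact h₂.not_two_edges hxp hyq h_xy hxq (fun h => hyp h.symm) (fun h => hqp h.symm)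
      exact h₃ hxp hpz h_yz.symm hyq hxq.symm hxz h_xy (fun h => hyp h.symm)
        (fun h => hqp h.symm) hzq
  refine ⟨L, ⟨fun _ c x z hP h1 h2 => ?_, by simp, by simp⟩, by simp, by simp,
    fun _ c x z hP h1 h2 => ?_⟩
  · obtain ⟨h3, h4, h5, -⟩ := isP3_compl_iff.1 hP
    exact key c x z h1 h2 h5 h3
  · exact key x z c h1 h2 hP.2.1.symm hP.2.2.1

/-- If `v` has least positive degree, the other nonisolated vertices form a clique, so every induced
path has `v` as an end. The order is: clique vertices not adjacent to `v`, neighbours of `v`, then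
`v`, then isolated vertices. -/
theorem AlternatingFree.exists_avoids_of_clawFree [Finite V] (h : AlternatingFree G)
    (hclaw : ClawFree G) :
    ∃ L : LinearOrder V, Avoids L Gᶜ (true, true, false) ∧ Avoids L G (true, false, true) := by
  classical
  by_cases hne : {x | ∃ y, G.Adj x y}.Nonempty
  swap
  · obtain ⟨L, -⟩ := exists_linearOrder_of_key (fun _ : V => (0 : ℕ))
    have hno : ∀ x y, ¬ G.Adj x y := fun x y hxy => hne ⟨x, y, hxy⟩
    refine ⟨L, ⟨fun _ c x z hP => ?_, fun _ c x z hP => ?_, by simp⟩,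
      fun _ c x z hP => (hno _ _ hP.1).elim, by simp, fun _ c x z hP => (hno _ _ hP.1).elim⟩
    all_goals exact (hno _ _ (isP3_compl_iff.1 hP).2.2.1).elim
  obtain ⟨v, ⟨v', hvv'⟩, hmin⟩ := Set.exists_min_image {x | ∃ y, G.Adj x y}
    (fun x => (G.neighborSet x).ncard) (Set.toFinite _) hne
  have clique : ∀ a b, (∃ y, G.Adj a y) → (∃ y, G.Adj b y) → a ≠ v → b ≠ v → a ≠ b →
      G.Adj a b := by
    have main : ∀ a b, (∃ y, G.Adj b y) → b ≠ v → a ≠ b → G.Adj v a → G.Adj a b := by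
      intro a b hb hbv hab hva
      by_contra hnab
      have : ∃ p, G.Adj b p ∧ ¬ G.Adj v p ∧ p ≠ v := by
        by_cases hvb : G.Adj v b
        · exact exists_adj_of_adj_of_ncard_neighborSet_le (hmin b hb) hvb hva
            (fun h => hnab h.symm) hab
        · obtain ⟨p, h1, h2⟩ := exists_adj_of_ncard_neighborSet_le (hmin b hb) hva
            (fun h => hnab h.symm)
          exact ⟨p, h1, h2, by rintro rfl; exact hvb h1.symm⟩
      obtain ⟨p, h1, h2, h3⟩ := this
      exact h hva h1.symm h2 h3.symm hnab hab
    intro a b ha hb hav hbv hab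
    by_cases hva : G.Adj v a
    · exact main a b hb hbv hab hva
    by_cases hvb : G.Adj v b
    · exact (main b a ha hav hab.symm hvb).symm
    by_contra hnab
    -- The neighbour `v'` of `v` is then adjacent to both `a` and `b`, which makes a claw with
    -- leaves `v`, `a`, `b`.
    have hcommon : ∀ d, (∃ y, G.Adj d y) → ¬ G.Adj v d → d ≠ v → G.Adj d v' := by
      intro d hd hvd hdv
      by_contra hcon
      obtain ⟨p, h1, h2⟩ := exists_adj_of_ncard_neighborSet_le (hmin d hd) hvv' hcon
      refine h hvv' h1.symm h2 ?_ (fun h => hcon h.symm) ?_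
      · rintro rfl; exact hvd h1.symm
      · rintro rfl; exact hvd hvv'
    have h1 := (hcommon a ha hva hav).symm
    have h2 := (hcommon b hb hvb hbv).symm
    exact hclaw (c := v') (x := v) (y := a) (z := b) ⟨hvv'.symm, h1, hva, hav.symm⟩
      ⟨h1, h2, hnab, hab⟩ ⟨hvv'.symm, h2, hvb, hbv.symm⟩
  obtain ⟨L, hL⟩ := exists_linearOrder_of_key (fun x : V =>
    if ∃ y, G.Adj x y then (if x = v then 2 else if G.Adj v x then 1 else 0) else (3 : ℕ))
  have hP3 : ∀ c x z, IsP3 G c x z → (L.lt c x ∧ L.lt c z) ∨ (L.lt x c ∧ L.lt z c) → False := by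
    have main : ∀ c x, IsP3 G c x v → (L.lt c x ∧ L.lt c v) ∨ (L.lt x c ∧ L.lt v c) → False := by
      rintro c x hP (⟨h1, h2⟩ | ⟨h1, h2⟩)
      · have h3 := hL _ _ h1
        have hc : ∃ y, G.Adj c y := ⟨_, hP.1⟩
        have hx : ∃ y, G.Adj x y := ⟨_, hP.1.symm⟩
        have hvx : ¬ G.Adj v x := fun h' => hP.2.2.1 h'.symm
        simp [hc, hx, hP.2.2.2, hP.2.1.symm, hP.2.1.ne, hvx] at h3
      · have h3 := hL _ _ h2
        have hc : ∃ y, G.Adj c y := ⟨_, hP.1⟩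
        have hv : ∃ y, G.Adj v y := ⟨_, hvv'⟩
        simp [hc, hv, hP.2.1.symm, hP.2.1.ne] at h3
    intro c x z hP hor
    by_cases hz : z = v
    · subst hz; exact main c x hP hor
    by_cases hx : x = v
    · subst hx; exact main c z hP.symm (hor.imp And.symm And.symm)
    exact hP.2.2.1 (clique x z ⟨_, hP.1.symm⟩ ⟨_, hP.2.1.symm⟩ hx hz hP.2.2.2)
  have hP3' : ∀ c x z, IsP3 Gᶜ c x z → ¬ L.lt c z := by
    intro c x z hP hlt
    obtain ⟨h1, h2, h3, h4, h5⟩ := isP3_compl_iff.1 hP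
    have h6 := hL _ _ hlt
    have hz : ∃ y, G.Adj z y := ⟨_, h3.symm⟩
    have hx : ∃ y, G.Adj x y := ⟨_, h3⟩
    by_cases hc : ∃ y, G.Adj c y
    · by_cases hcv : c = v
      · subst hcv
        simp [hc, hz, h5.symm, h2] at h6
      · by_cases hxv : x = v
        · have hzv : z ≠ v := by rintro rfl; exact h3.ne hxv
          exact h2 (clique c z hc hz hcv hzv h5)
        · exact h1 (clique c x hc hx hcv hxv h4)
    · simp only [hc, hz, if_true, if_false] at h6
      split_ifs at h6 <;> omega
  refine ⟨L, ⟨fun _ c x z hP h1 h2 => hP3' _ _ _ hP (h1.trans h2),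
    fun _ c x z hP h1 h2 => hP3' _ _ _ hP h2, by simp⟩,
    fun _ c x z hP h1 h2 => hP3 _ _ _ hP (.inl ⟨h1, h1.trans h2⟩), by simp,
    fun _ c x z hP h1 h2 => hP3 _ _ _ hP (.inr ⟨h1.trans h2, h2⟩)⟩

/-- With `w` as centre, each edge is a path of the complement. Two edges sharing a vertex `b` would
link `(w, b)` with `(b, w)`, so the edges form a matching, and a threshold graph then has at most
one edge. Its ends go to the two extremes of the order. -/
theorem AlternatingFree.exists_avoids_of_isolated [Finite V] (h : AlternatingFree G)
    (hF : NoCircuit F)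
    (hAf : ∀ c x z, IsP3 Gᶜ c x z → F c x z) (hAl : ∀ c x z, IsP3 Gᶜ c x z → F x z c)
    (hBf : ∀ c x z, IsP3 G c x z → F c x z) (hBl : ∀ c x z, IsP3 G c x z → F x z c)
    (w : V) (hw : ∀ x, ¬ G.Adj w x) :
    ∃ L : LinearOrder V, Avoids L Gᶜ (true, false, true) ∧ Avoids L G (true, false, true) := by
  classical
  have isol : ∀ {a b}, G.Adj a b → IsP3 Gᶜ w a b := fun {a b} hab => isP3_compl_iff.2
    ⟨hw a, hw b, hab, by rintro rfl; exact hw b hab, by rintro rfl; exact hw a hab.symm⟩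
  have matching : ∀ a b c, G.Adj a b → G.Adj b c → a = c := by
    intro a b c hab hbc
    by_contra hac
    have hwb : w ≠ b := by rintro rfl; exact hw _ hbc
    have e1 := linked_of_isP3 hAf hAl (isol hab)
    have e2 := linked_of_isP3 hAf hAl (isol hbc)
    refine hF.not_linked_swap hwb ?_
    by_cases hac' : G.Adj a c
    · have e3 := linked_of_isP3 hAf hAl (isol hac')
      exact e1.2.2.symm.trans (e3.2.2.trans e2.2.2.symm)
    · have e3 := linked_of_isP3 hBf hBl (c := b) ⟨hab.symm, hbc, hac', hac⟩
      exact e1.2.1.symm.trans (e3.2.2.trans e2.1.symm)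
  have hB : ∀ L : LinearOrder V, Avoids L G (true, false, true) := fun L =>
    ⟨fun _ c x z hP => (hP.2.2.2 (matching x c z hP.1.symm hP.2.1)).elim, by simp,
      fun _ c x z hP => (hP.2.2.2 (matching x c z hP.1.symm hP.2.1)).elim⟩
  by_cases hne : ∃ u v, G.Adj u v
  swap
  · obtain ⟨L, -⟩ := exists_linearOrder_of_key (fun _ : V => (0 : ℕ))
    refine ⟨L, ⟨fun _ c x z hP => ?_, by simp, fun _ c x z hP => ?_⟩, hB L⟩
    all_goals exact (hne ⟨_, _, (isP3_compl_iff.1 hP).2.2.1⟩).elim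
  obtain ⟨u, v, huv⟩ := hne
  have unique : ∀ a b, G.Adj a b → (a = u ∧ b = v) ∨ (a = v ∧ b = u) := by
    intro a b hab
    by_cases hau : a = u
    · subst hau
      exact .inl ⟨rfl, (matching v a b huv.symm hab).symm⟩
    by_cases hua : G.Adj u a
    · have hav := matching v u a huv.symm hua
      subst hav
      exact .inr ⟨rfl, (matching u v b huv hab).symm⟩
    by_cases hbv : b = v
    · subst hbv
      exact (hau (matching a b u hab huv.symm)).elim
    by_cases hvb : G.Adj v b
    · have := matching u v b huv hvb
      subst this
      exact (hua hab.symm).elim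
    · exact (h huv hab hua (Ne.symm hau) hvb (Ne.symm hbv)).elim
  obtain ⟨L, hL⟩ := exists_linearOrder_of_key (fun x : V =>
    if x = u then 0 else if x = v then 2 else (1 : ℕ))
  refine ⟨L, ⟨fun _ c x z hP h1 h2 => ?_, by simp, fun _ c x z hP h1 h2 => ?_⟩, hB L⟩
  all_goals
    obtain ⟨-, -, h3, h4, h5⟩ := isP3_compl_iff.1 hP
    have h6 := hL _ _ h1
    have h7 := hL _ _ h2
    rcases unique x z h3 with ⟨rfl, rfl⟩ | ⟨rfl, rfl⟩
    · simp [h3.ne', h4, h5] at h6 h7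
    · simp [h3.ne, h4, h5] at h6 h7

/-- A threshold graph has an isolated or a dominating vertex, and the latter is isolated in the
complement. -/
theorem exists_avoids_first_last_of_all [Finite V] (hF : NoCircuit F)
    (hAf : ∀ c x z, IsP3 Gᶜ c x z → F c x z) (hAl : ∀ c x z, IsP3 Gᶜ c x z → F x z c)
    (hBf : ∀ c x z, IsP3 G c x z → F c x z) (hBl : ∀ c x z, IsP3 G c x z → F x z c) :
    ∃ L : LinearOrder V, Avoids L Gᶜ (true, false, true) ∧ Avoids L G (true, false, true) := by
  have hG := alternatingFree_of_first_of_first hF hAf hBf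
  rcases isEmpty_or_nonempty V with hV | hV
  · obtain ⟨L, -⟩ := exists_linearOrder_of_key (fun _ : V => (0 : ℕ))
    exact ⟨L, ⟨fun _ c => hV.elim c, fun _ c => hV.elim c, fun _ c => hV.elim c⟩,
      fun _ c => hV.elim c, fun _ c => hV.elim c, fun _ c => hV.elim c⟩
  obtain ⟨s, -, hs | hs⟩ := hG.exists_dominating_or_isolated Set.univ Set.univ_nonempty
  · have hcc := compl_compl G
    obtain ⟨L, h1, h2⟩ := hG.compl.exists_avoids_of_isolated hF (by rwa [hcc]) (by rwa [hcc])
      hAf hAl s (fun x hx => hx.2 (hs x trivial hx.1.symm))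
    exact ⟨L, h2, by rwa [hcc] at h1⟩
  · exact hG.exists_avoids_of_isolated hF hAf hAl hBf hBl s fun x => hs x trivial

end SortingOrders

/-! ### Transitive orientations and forcing classes -/

section TransitiveOrientations

variable {V : Type*} {G : SimpleGraph V} {F : V → V → V → Prop}

/-- `D` is a transitive orientation of the graph `G`. -/
structure IsTransitiveOrientation (G : SimpleGraph V) (D : V → V → Prop) : Prop where
  adj : ∀ {x y}, D x y → G.Adj x y
  trans : ∀ {x y z}, D x y → D y z → D x z
  total : ∀ {x y}, G.Adj x y → D x y ∨ D y x

theorem IsTransitiveOrientation.asymm {D : V → V → Prop} (h : IsTransitiveOrientation G D)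
    {x y : V} (h1 : D x y) (h2 : D y x) : False :=
  (h.adj (h.trans h1 h2)).ne rfl

theorem IsTransitiveOrientation.not_both {D : V → V → Prop} (h : IsTransitiveOrientation G D)
    {c x z : V} (hP : IsP3 G c x z) (h1 : D x c) (h2 : D c z) : False :=
  hP.2.2.1 (h.adj (h.trans h1 h2))

/-- `D` is closed under the forcing relation of transitive orientations. -/
def ForceClosed (G : SimpleGraph V) (D : V → V → Prop) : Prop :=
  ∀ ⦃c x z⦄, IsP3 G c x z → (D x c → D z c) ∧ (D c x → D c z)

theorem ForceClosed.of_reach {D : V → V → Prop} (hD : ForceClosed G D) {p q : V × V}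
    (h : Reach (fun x c z => IsP3 G c x z) p q) (hp : D p.1 p.2) : D q.1 q.2 := by
  induction h with
  | refl => exact hp
  | tail _ h ih =>
    obtain ⟨x, c, z, hP, ⟨rfl, rfl⟩ | ⟨rfl, rfl⟩⟩ := h
    · exact (hD hP).1 ih
    · exact (hD hP.symm).2 ih

theorem forceClosed_reach (p : V × V) :
    ForceClosed G fun x y => Reach (fun x c z => IsP3 G c x z) p (x, y) :=
  fun _ _ _ hP => ⟨fun h => h.trans (Reach.left (F := fun x c z => IsP3 G c x z) hP),
    fun h => h.trans (Reach.right (F := fun x c z => IsP3 G c x z) hP.symm)⟩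

theorem reach_isP3_symm {p q : V × V} (h : Reach (fun x c z => IsP3 G c x z) p q) :
    Reach (fun x c z => IsP3 G c x z) q p := by
  refine Reach.flip (ReflTransGen.mono ?_ _ _ h)
  rintro _ _ ⟨x, c, z, hP, h⟩
  exact ⟨x, c, z, hP.symm, h⟩

/-- If `z` is adjacent to the vertex next to `c` on the chain, induction applies to the shorter
chain; if not, one forcing step at `c` suffices. -/
theorem ForceClosed.transGen {D : V → V → Prop} (hD : ForceClosed G D)
    (hadj : ∀ x y, TransGen D x y → G.Adj x y) : ForceClosed G (TransGen D) := by
  intro c x z hP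
  constructor
  · intro h
    induction h with
    | single h => exact .single ((hD hP).1 h)
    | @tail a c hxa hac ih =>
      have hxa' := hadj _ _ hxa
      by_cases hza : G.Adj z a
      · exact .tail (ih ⟨hxa'.symm, hza.symm, hP.2.2⟩) hac
      · refine .single ((hD (c := c) (x := a) (z := z)
          ⟨(hadj _ _ (.single hac)).symm, hP.2.1, fun h => hza h.symm, ?_⟩).1 hac)
        rintro rfl
        exact hP.2.2.1 hxa'
  · intro h
    induction h using TransGen.head_induction_on with
    | single h => exact .single ((hD hP).2 h)
    | @head c a hca hax ih =>
      have hax' := hadj _ _ hax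
      by_cases hza : G.Adj z a
      · exact .head hca (ih ⟨hax', hza.symm, hP.2.2⟩)
      · refine .single ((hD (c := c) (x := a) (z := z)
          ⟨hadj _ _ (.single hca), hP.2.1, fun h => hza h.symm, ?_⟩).2 hca)
        rintro rfl
        exact hP.2.2.1 hax'.symm

/-- How a closed set `Q` of oriented edges interacts with the forcing class `S` of a pair. -/
theorem ForceClosed.propagate {S Q : V → V → Prop} {p : V × V}
    (hS : S = fun x y => Reach (fun x c z => IsP3 G c x z) p (x, y))
    (hQ : ForceClosed G Q) (hQadj : ∀ {x y}, Q x y → G.Adj x y)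
    (hSadj : ∀ {x y}, S x y → G.Adj x y) (hQS : ∀ {x y}, Q x y → S y x → False) {a b c : V}
    (hca : Q c a) (hab : S a b) (hcb : ¬ S c b) {a' b' : V} (hab' : S a' b') :
    Q c a' ∧ G.Adj c b' ∧ ¬ S c b' := by
  have hScl : ForceClosed G S := hS ▸ forceClosed_reach p
  have hreach : Reach (fun x c z => IsP3 G c x z) (a, b) (a', b') := by
    subst hS
    exact (reach_isP3_symm hab).trans hab'
  -- This is the triangle lemma: the apex `c` is carried along each forcing step that moves the base
  -- edge.
  suffices ∀ q : V × V, Reach (fun x c z => IsP3 G c x z) (a, b) q →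
      S q.1 q.2 ∧ Q c q.1 ∧ G.Adj c q.2 ∧ ¬ S c q.2 from (this _ hreach).2
  intro q hq
  induction hq with
  | refl =>
    refine ⟨hab, hca, ?_, hcb⟩
    by_contra hcb'
    refine hQS ((hQ (c := a) (x := c) (z := b) ⟨(hQadj hca).symm, hSadj hab, hcb', ?_⟩).1 hca) hab
    rintro rfl
    exact hQS hca hab
  | tail _ h ih =>
    obtain ⟨x, m, z, hP, ⟨rfl, rfl⟩ | ⟨rfl, rfl⟩⟩ := h
    · obtain ⟨h1, h2, h3, h4⟩ := ih
      have h5 : S z m := (hScl hP).1 h1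
      refine ⟨h5, ?_, h3, h4⟩
      have hcz : G.Adj c z := by
        by_contra hcz
        refine h4 ((hScl (c := m) (x := z) (z := c)
          ⟨hP.2.1, h3.symm, fun h => hcz h.symm, ?_⟩).1 h5)
        rintro rfl
        exact h4 h5
      exact (hQ (c := c) ⟨hQadj h2, hcz, hP.2.2⟩).2 h2
    · obtain ⟨h1, h2, h3, h4⟩ := ih
      have h5 : S m x := (hScl hP.symm).2 h1
      have hcx : G.Adj c x := by
        by_contra hcx
        refine hQS ((hQ (c := m) (x := c) (z := x) ⟨(hQadj h2).symm, hP.1, hcx, ?_⟩).1 h2) h5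
        rintro rfl
        exact hP.2.2.1 h3
      exact ⟨h5, h2, hcx, fun h => h4 ((hScl (c := c) (x := x) (z := z) ⟨hcx, h3, hP.2.2⟩).2 h)⟩

theorem NoCircuit.mono {F' : V → V → V → Prop} (h : NoCircuit F) (hle : ∀ x y z, F' x y z → F x y z) :
    NoCircuit F' := by
  have hreach : ∀ {p q}, Reach F' p q → Reach F p q := fun {p q} hpq =>
    ReflTransGen.mono (fun _ _ ⟨x, y, z, hF, h⟩ => ⟨x, y, z, hle _ _ _ hF, h⟩) p q hpq
  exact fun p v hv => h p v
    (TransGen.mono (fun x y hxy => ⟨hxy.1, hreach hxy.2.1, hreach hxy.2.2⟩) v v hv)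

/-- Take a maximal transitive, force-closed set `D` of oriented edges. If an edge `u v` were
unoriented, adding its forcing class `S` and closing transitively would give a larger such set; the
point is that the closure still consists of edges. -/
theorem exists_isTransitiveOrientation [Finite V] (hF : NoCircuit F)
    (hm : ∀ c x z, IsP3 G c x z → F x c z) : ∃ D, IsTransitiveOrientation G D := by
  have hF0 : NoCircuit fun x c z => IsP3 G c x z := hF.mono fun x c z h => hm c x z h
  obtain ⟨D, ⟨hadj, htrans, hcl⟩, hmax⟩ := Set.Finite.exists_maximal
    (s := {D : V → V → Prop | (∀ x y, D x y → G.Adj x y) ∧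
      (∀ x y z, D x y → D y z → D x z) ∧ ForceClosed G D}) (Set.toFinite _)
    ⟨fun _ _ => False, by simp, by simp, fun _ _ _ _ => ⟨id, id⟩⟩
  refine ⟨D, hadj _ _, htrans _ _ _, fun {u v} huv => ?_⟩
  by_contra hcon
  push Not at hcon
  obtain ⟨huv1, huv2⟩ := hcon
  obtain ⟨S, hS⟩ : ∃ S : V → V → Prop,
    S = fun x y => Reach (fun x c z => IsP3 G c x z) (u, v) (x, y) := ⟨_, rfl⟩
  have hScl : ForceClosed G S := hS ▸ forceClosed_reach (u, v)
  have hSadj : ∀ {x y}, S x y → G.Adj x y := by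
    intro x y hxy
    subst hS
    have hcl : ForceClosed G G.Adj := fun c x z hP => ⟨fun _ => hP.2.1.symm, fun _ => hP.2.1⟩
    exact hcl.of_reach hxy huv
  have hSS : ∀ {x y}, S x y → S y x → False := by
    intro x y hxy hyx
    have hne := (hSadj hxy).ne
    subst hS
    have e := (reach_isP3_symm hxy).trans hyx
    exact hF0.not_linked_swap hne ⟨e, reach_isP3_symm e⟩
  have hDS : ∀ {x y}, D x y → S y x → False := by
    intro x y hxy hyx
    subst hS
    exact huv2 (hcl.of_reach (Reach.swap hyx) hxy)
  have hSdiag : ∀ {x}, ¬ S x x := fun h => (hSadj h).ne rfl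
  have hStrans : ∀ {x y z}, S x y → S y z → S x z := by
    intro x y z hxy hyz
    by_contra hxz
    exact hSdiag (hScl.propagate hS hSadj hSadj hSS hxy hyz hxz hxy).1
  have hSDS : ∀ {a b c d}, S a b → D b c → S c d → S b d := by
    intro a b c d hab hbc hcd
    by_contra hbd
    exact hDS (hcl.propagate hS (hadj _ _) hSadj hDS hbc hcd hbd hab).1 hab
  have hadjSD : ∀ {a b c}, S a b → D b c → G.Adj a c := by
    intro a b c hab hbc
    by_contra hac
    refine hDS ((hcl (c := b) (x := c) (z := a)
      ⟨hadj _ _ hbc, (hSadj hab).symm, fun h => hac h.symm, ?_⟩).2 hbc) hab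
    rintro rfl
    exact hDS hbc hab
  have hadjDS : ∀ {a b c}, D a b → S b c → G.Adj a c := by
    intro a b c hab hbc
    by_contra hac
    refine hDS ((hcl (c := b) (x := a) (z := c)
      ⟨(hadj _ _ hab).symm, hSadj hbc, hac, ?_⟩).1 hab) hbc
    rintro rfl
    exact hDS hab hbc
  -- Since `S` is transitive and `S`-`D`-`S` walks collapse into `S`, one step in `S` is enough.
  have hdecomp : ∀ x y, TransGen (fun x y => D x y ∨ S x y) x y →
      D x y ∨ ∃ a b, (x = a ∨ D x a) ∧ S a b ∧ (b = y ∨ D b y) := by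
    intro x y h
    induction h with
    | single h =>
      rcases h with h | h
      · exact .inl h
      · exact .inr ⟨_, _, .inl rfl, h, .inl rfl⟩
    | @tail y z _ hyz ih =>
      rcases ih with hxy | ⟨a, b, hxa, hab, hby⟩ <;> rcases hyz with hyz | hyz
      · exact .inl (htrans _ _ _ hxy hyz)
      · exact .inr ⟨y, z, .inr hxy, hyz, .inl rfl⟩
      · refine .inr ⟨a, b, hxa, hab, .inr ?_⟩
        rcases hby with rfl | hby
        · exact hyz
        · exact htrans _ _ _ hby hyz
      · refine .inr ⟨a, z, hxa, ?_, .inl rfl⟩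
        rcases hby with rfl | hby
        · exact hStrans hab hyz
        · exact hStrans hab (hSDS hab hby hyz)
  have hadjT : ∀ x y, TransGen (fun x y => D x y ∨ S x y) x y → G.Adj x y := by
    intro x y h
    rcases hdecomp x y h with h | ⟨a, b, rfl | hxa, hab, rfl | hby⟩
    · exact hadj _ _ h
    · exact hSadj hab
    · exact hadjSD hab hby
    · exact hadjDS hxa hab
    · by_contra hxy
      refine hDS (htrans _ _ _ ((hcl (c := b) (x := y) (z := x) ⟨hadj _ _ hby,
        (hadjDS hxa hab).symm, fun h => hxy h.symm, ?_⟩).2 hby) hxa) hab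
      rintro rfl
      exact hDS (htrans _ _ _ hby hxa) hab
  have hQcl : ForceClosed G fun x y => D x y ∨ S x y := fun c x z hP =>
    ⟨Or.imp (hcl hP).1 (hScl hP).1, Or.imp (hcl hP).2 (hScl hP).2⟩
  refine huv1 (hmax (y := TransGen fun x y => D x y ∨ S x y)
    ⟨hadjT, fun _ _ _ => TransGen.trans, hQcl.transGen hadjT⟩
    (fun x y hxy => .single (.inl hxy)) u v (.single (.inr ?_)))
  subst hS
  exact .refl

theorem IsTransitiveOrientation.exists_avoids_mid {D : V → V → Prop}
    (hD : IsTransitiveOrientation G D) :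
    ∃ L : LinearOrder V, Avoids L G (false, true, false) := by
  obtain ⟨L, hL⟩ := exists_linearOrder_of_acyclic D (fun v hv => by
    have : IsTrans V D := ⟨fun _ _ _ => hD.trans⟩
    rw [transGen_eq_self] at hv
    exact (hD.adj hv).ne rfl)
  have key : ∀ x y, G.Adj x y → L.lt x y → D x y := fun x y hxy hlt =>
    (hD.total hxy).resolve_right fun h => lt_asymm hlt (hL _ _ h)
  exact ⟨L, by simp, fun _ c x z hP h1 h2 =>
    hD.not_both hP (key _ _ hP.1.symm h1) (key _ _ hP.2.1 h2), by simp⟩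

/-- The union is a tournament. In a cyclic triangle two of the three arcs come from the same
orientation and compose to the reverse of the third, so the tournament is transitive. -/
theorem IsTransitiveOrientation.exists_avoids_mid_and_mid {D D' : V → V → Prop}
    (hD : IsTransitiveOrientation G D) (hD' : IsTransitiveOrientation Gᶜ D') :
    ∃ L : LinearOrder V, Avoids L Gᶜ (false, true, false) ∧ Avoids L G (false, true, false) := by
  have hdisj : ∀ {x y}, G.Adj x y → Gᶜ.Adj x y → False := fun h h' => h'.2 h
  have htot : ∀ {x y}, x ≠ y → (D x y ∨ D' x y) ∨ (D y x ∨ D' y x) := by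
    intro x y hne
    by_cases hxy : G.Adj x y
    · exact (hD.total hxy).imp .inl .inl
    · exact (hD'.total (x := x) (y := y) ⟨hne, hxy⟩).imp .inr .inr
  have hasymm : ∀ {x y}, (D x y ∨ D' x y) → (D y x ∨ D' y x) → False := by
    rintro x y (h | h) (h' | h')
    · exact hD.asymm h h'
    · exact hdisj (hD.adj h).symm (hD'.adj h')
    · exact hdisj (hD.adj h') (hD'.adj h).symm
    · exact hD'.asymm h h'
  have htrans : ∀ x y z, (D x y ∨ D' x y) → (D y z ∨ D' y z) → D x z ∨ D' x z := by
    intro x y z hxy hyz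
    have hne : x ≠ z := by rintro rfl; exact hasymm hxy hyz
    refine (htot hne).resolve_right fun hzx => ?_
    rcases hxy with h1 | h1 <;> rcases hyz with h2 | h2
    · exact hasymm (.inl (hD.trans h1 h2)) hzx
    · rcases hzx with h3 | h3
      · exact hasymm (.inl (hD.trans h3 h1)) (.inr h2)
      · exact hasymm (.inr (hD'.trans h2 h3)) (.inl h1)
    · rcases hzx with h3 | h3
      · exact hasymm (.inl (hD.trans h2 h3)) (.inr h1)
      · exact hasymm (.inr (hD'.trans h3 h1)) (.inl h2)
    · exact hasymm (.inr (hD'.trans h1 h2)) hzx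
  obtain ⟨L, hL⟩ := exists_linearOrder_of_acyclic (fun x y => D x y ∨ D' x y) (fun v hv => by
    have : IsTrans V fun x y => D x y ∨ D' x y := ⟨htrans⟩
    rw [transGen_eq_self] at hv
    exact hasymm hv hv)
  have key : ∀ x y, L.lt x y → D x y ∨ D' x y := fun x y hlt =>
    (htot hlt.ne).resolve_right fun h => lt_asymm hlt (hL _ _ h)
  refine ⟨L, ⟨by simp, fun _ c x z hP h1 h2 => ?_, by simp⟩,
    by simp, fun _ c x z hP h1 h2 => ?_, by simp⟩
  · refine hD'.not_both hP ((key _ _ h1).resolve_left fun h => ?_)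
      ((key _ _ h2).resolve_left fun h => ?_)
    · exact hdisj (hD.adj h) hP.1.symm
    · exact hdisj (hD.adj h) hP.2.1
  · refine hD.not_both hP ((key _ _ h1).resolve_right fun h => ?_)
      ((key _ _ h2).resolve_right fun h => ?_)
    · exact hdisj hP.1.symm (hD'.adj h)
    · exact hdisj hP.2.1 (hD'.adj h)

/-! ### Interval orders and semiorders -/

section Interval

variable {D : V → V → Prop}

theorem IsTransitiveOrientation.flip (hD : IsTransitiveOrientation G D) :
    IsTransitiveOrientation G fun x y => D y x :=
  ⟨fun h => (hD.adj h).symm, fun h1 h2 => hD.trans h2 h1, fun h => hD.total h.symm⟩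

theorem IsTransitiveOrientation.adj_of_not (hD : IsTransitiveOrientation Gᶜ D) {x y : V}
    (hne : x ≠ y) (h1 : ¬ D x y) (h2 : ¬ D y x) : G.Adj x y := by
  by_contra h
  exact (hD.total ⟨hne, h⟩).elim h1 h2

/-- The sets of predecessors in an interval order form a chain. -/
theorem IsTransitiveOrientation.predecessors_nested (hD : IsTransitiveOrientation Gᶜ D)
    (hG : SquareFree G) {a b x y : V} (hax : D a x) (hay : ¬ D a y) (hby : D b y) (hbx : ¬ D b x) :
    False := by
  have hab1 : ¬ D a b := fun h => hay (hD.trans h hby)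
  have hab2 : ¬ D b a := fun h => hbx (hD.trans h hax)
  have hxy1 : ¬ D x y := fun h => hay (hD.trans hax h)
  have hxy2 : ¬ D y x := fun h => hbx (hD.trans hby h)
  have hya : ¬ D y a := fun h => hab2 (hD.trans hby h)
  have hxb : ¬ D x b := fun h => hab1 (hD.trans hax h)
  have hab : a ≠ b := by rintro rfl; exact hay hby
  have hxy : x ≠ y := by rintro rfl; exact hay hax
  have hay' : a ≠ y := by rintro rfl; exact hab2 hby
  have hbx' : b ≠ x := by rintro rfl; exact hab1 hax
  exact hG (hD.adj_of_not hay' hay hya) (hD.adj_of_not hxy hxy1 hxy2).symm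
    (hD.adj_of_not hbx' hbx hxb).symm (hD.adj_of_not hab hab1 hab2).symm (hD.adj hax).2
    (hD.adj hax).ne (fun h => (hD.adj hby).2 h.symm) (hD.adj hby).ne'

variable [Finite V]

theorem IsTransitiveOrientation.predecessors_subset (hD : IsTransitiveOrientation Gᶜ D)
    (hG : SquareFree G) {x y : V} (hle : {w | D w x}.ncard ≤ {w | D w y}.ncard) :
    {w | D w x} ⊆ {w | D w y} := by
  intro a hax
  by_contra hay
  have : {w | D w y}.ncard < {w | D w x}.ncard := by
    refine Set.ncard_lt_ncard ⟨fun b hby => ?_, fun h => hay (h hax)⟩ (Set.toFinite _)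
    by_contra hbx
    exact hD.predecessors_nested hG hax hay hby hbx
  omega

theorem IsTransitiveOrientation.lt_of_le (hD : IsTransitiveOrientation Gᶜ D)
    (hG : SquareFree G) {x y : V} (hle : {w | D w x}.ncard ≤ {w | D w y}.ncard)
    (hne : x ≠ y) (hxy : ¬ G.Adj x y) : D x y := by
  refine (hD.total ⟨hne, hxy⟩).resolve_right fun h => ?_
  exact (hD.adj (hD.predecessors_subset hG hle h)).ne rfl

/-- Sorting by number of predecessors makes the predecessor sets increase, so a nonneighbour that
comes earlier is a predecessor and stays one for all later vertices. -/
theorem IsTransitiveOrientation.exists_avoids_interval (hD : IsTransitiveOrientation Gᶜ D)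
    (hG : SquareFree G) :
    ∃ L : LinearOrder V, Avoids L Gᶜ (false, true, false) ∧ Avoids L G (false, false, true) := by
  obtain ⟨L, hL⟩ := exists_linearOrder_of_key (fun v => {w | D w v}.ncard)
  refine ⟨L, ⟨by simp, fun _ c x z hP h1 h2 => ?_, by simp⟩,
    by simp, by simp, fun _ c x z hP h1 h2 => ?_⟩
  · obtain ⟨h3, h4, h5, h6, h7⟩ := isP3_compl_iff.1 hP
    have hxc : D x c := hD.lt_of_le hG (hL _ _ h1) h6.symm fun h => h3 h.symm
    exact (hD.adj (hD.predecessors_subset hG (hL _ _ h2) hxc)).2 h5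
  · have hxz : D x z := hD.lt_of_le hG (hL _ _ h1) hP.2.2.2 hP.2.2.1
    exact (hD.adj (hD.predecessors_subset hG (hL _ _ h2) hxz)).2 hP.1.symm

/-- The number of predecessors settles the complement as for interval orders; breaking ties by
decreasing degree puts every centre before its ends. -/
theorem IsTransitiveOrientation.exists_avoids_nested (hD : IsTransitiveOrientation Gᶜ D)
    (hG : NestedNeighborhoods G) :
    ∃ L : LinearOrder V, Avoids L Gᶜ (false, true, false) ∧ Avoids L G (false, true, true) := by
  obtain ⟨L, hL⟩ := exists_linearOrder_of_key (fun v => toLex ({w | D w v}.ncard,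
    OrderDual.toDual (G.neighborSet v).ncard))
  have hL1 : ∀ x y, L.lt x y → {w | D w x}.ncard ≤ {w | D w y}.ncard := by
    intro x y h
    rcases Prod.Lex.le_iff.1 (hL x y h) with h | h
    · exact h.le
    · exact h.1.le
  have hcentre : ∀ c x z, IsP3 G c x z → ¬ L.lt x c := by
    intro c x z hP hlt
    -- Otherwise `x` is the centre of a path from `w` to `c`, while `c` is the centre of one ending
    -- at `x`.
    have hsub : {w | D w c} ⊆ {w | D w x} := by
      intro w hwc
      by_contra hwx
      have hne : w ≠ x := by rintro rfl; exact (hD.adj hwc).2 hP.1.symm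
      by_cases hxw : D x w
      · exact (hD.adj (hD.trans hxw hwc)).2 hP.1.symm
      · exact hG hP.symm (b := w) ⟨(hD.adj_of_not hne hwx hxw).symm, hP.1.symm, (hD.adj hwc).2,
          (hD.adj hwc).ne⟩
    have h1 := Set.ncard_le_ncard hsub (Set.toFinite _)
    have h2 := hG.ncard_lt hP
    rcases Prod.Lex.le_iff.1 (hL _ _ hlt) with h | h
    · have h : {w | D w x}.ncard < {w | D w c}.ncard := h
      omega
    · have h : (G.neighborSet c).ncard ≤ (G.neighborSet x).ncard := h.2
      omega
  refine ⟨L, ⟨by simp, fun _ c x z hP h1 h2 => ?_, by simp⟩,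
    by simp, fun _ c x z hP h1 _ => hcentre c x z hP h1,
    fun _ c x z hP h1 h2 => hcentre c x z hP (h1.trans h2)⟩
  obtain ⟨h3, h4, h5, h6, h7⟩ := isP3_compl_iff.1 hP
  have hxc : D x c := hD.lt_of_le hG.squareFree (hL1 _ _ h1) h6.symm fun h => h3 h.symm
  exact (hD.adj (hD.predecessors_subset hG.squareFree (hL1 _ _ h2) hxc)).2 h5

/-- Sorting by predecessors minus successors makes both sets monotone: if both counts rose, or both
fell, there would be a chain of three elements incomparable to a fourth, hence a claw. -/
theorem IsTransitiveOrientation.exists_avoids_semiorder (hD : IsTransitiveOrientation Gᶜ D)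
    (hG : SquareFree G) (hclaw : ClawFree G) :
    ∃ L : LinearOrder V, Avoids L Gᶜ (false, true, false) ∧ Avoids L G (true, false, true) := by
  obtain ⟨L, hL⟩ := exists_linearOrder_of_key
    (fun v => ({w | D w v}.ncard : ℤ) - ({w | D v w}.ncard : ℤ))
  have hthree : ∀ {a b x y}, D a y → D y b → ¬ D a x → ¬ D x b → False := by
    intro a b x y hay hyb hax hxb
    have h1 : ¬ D x y := fun h => hxb (hD.trans h hyb)
    have h2 : ¬ D y x := fun h => hax (hD.trans hay h)
    have h3 : ¬ D x a := fun h => h1 (hD.trans h hay)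
    have h4 : ¬ D b x := fun h => h2 (hD.trans hyb h)
    have hxy : x ≠ y := by rintro rfl; exact hax hay
    have hxa : x ≠ a := by rintro rfl; exact h1 hay
    have hxb' : x ≠ b := by rintro rfl; exact h2 hyb
    have e1 := hD.adj_of_not hxa h3 hax
    have e2 := hD.adj_of_not hxy h1 h2
    have e3 := hD.adj_of_not hxb' hxb h4
    have hab := hD.trans hay hyb
    exact hclaw (c := x) (x := a) (y := y) (z := b) ⟨e1, e2, (hD.adj hay).2, (hD.adj hay).ne⟩
      ⟨e2, e3, (hD.adj hyb).2, (hD.adj hyb).ne⟩ ⟨e1, e3, (hD.adj hab).2, (hD.adj hab).ne⟩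
  have hsub : ∀ x y, L.lt x y → {w | D w x} ⊆ {w | D w y} ∧ {w | D y w} ⊆ {w | D x w} := by
    intro x y hlt
    have hle := hL x y hlt
    by_cases hp : {w | D w x}.ncard ≤ {w | D w y}.ncard
    · by_cases hs : {w | D y w}.ncard ≤ {w | D x w}.ncard
      · exact ⟨hD.predecessors_subset hG hp, hD.flip.predecessors_subset hG hs⟩
      · exfalso
        push Not at hs
        obtain ⟨b, hyb, hxb⟩ := Set.exists_mem_notMem_of_ncard_lt_ncard hs
        obtain ⟨a, hay, hax⟩ := Set.exists_mem_notMem_of_ncard_lt_ncard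
          (s := {w | D w x}) (t := {w | D w y}) (by omega)
        exact hthree hay hyb hax hxb
    · exfalso
      push Not at hp
      obtain ⟨a, hax, hay⟩ := Set.exists_mem_notMem_of_ncard_lt_ncard hp
      obtain ⟨b, hxb, hyb⟩ := Set.exists_mem_notMem_of_ncard_lt_ncard
        (s := {w | D y w}) (t := {w | D x w}) (by omega)
      exact hthree hax hxb hay hyb
  have hlt : ∀ x y, L.lt x y → ¬ G.Adj x y → D x y := by
    intro x y h hxy
    refine (hD.total ⟨h.ne, hxy⟩).resolve_right fun h' => ?_
    exact (hD.adj ((hsub x y h).1 h')).ne rfl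
  refine ⟨L, ⟨by simp, fun _ c x z hP h1 h2 => ?_, by simp⟩,
    fun _ c x z hP h1 h2 => ?_, by simp, fun _ c x z hP h1 h2 => ?_⟩
  · obtain ⟨h3, h4, h5, h6, h7⟩ := isP3_compl_iff.1 hP
    exact (hD.adj ((hsub c z h2).1 (hlt x c h1 fun h => h3 h.symm))).2 h5
  · exact (hD.adj ((hsub c x h1).2 (hlt x z h2 hP.2.2.1))).2 hP.2.1
  · exact (hD.adj ((hsub z c h2).1 (hlt x z h1 hP.2.2.1))).2 hP.1.symm

end Interval

end TransitiveOrientations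

section ProperIntervalAndChordal

variable {V : Type*} {G : SimpleGraph V} {F : V → V → V → Prop}

/-! ### Proper interval graphs -/

section ProperInterval

/-- Mutual reachability up to reversal of a pair. -/
def LinkedUpToSwap (F : V → V → V → Prop) (p q : V × V) : Prop :=
  Linked F p q ∨ Linked F p q.swap

theorem LinkedUpToSwap.symm {p q : V × V} (h : LinkedUpToSwap F p q) : LinkedUpToSwap F q p := by
  rcases h with h | h
  · exact .inl h.symm
  · exact .inr h.swap.symm

theorem LinkedUpToSwap.trans {p q r : V × V} (h : LinkedUpToSwap F p q)
    (h' : LinkedUpToSwap F q r) : LinkedUpToSwap F p r := by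
  rcases h with h | h <;> rcases h' with h' | h'
  · exact .inl (h.trans h')
  · exact .inr (h.trans h')
  · exact .inr (h.trans h'.swap)
  · exact .inl (h.trans h'.swap)

theorem LinkedUpToSwap.swap_left {x y : V} {q : V × V} (h : LinkedUpToSwap F (x, y) q) :
    LinkedUpToSwap F (y, x) q := by
  rcases h with h | h
  · exact .inr h.swap
  · exact .inl h.swap

theorem LinkedUpToSwap.swap_right {x y : V} {p : V × V} (h : LinkedUpToSwap F p (x, y)) :
    LinkedUpToSwap F p (y, x) :=
  h.symm.swap_left.symm

/-- The adjacent vertices `u` and `v` are the centre and an end of an induced path. -/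
def IsP3Edge (G : SimpleGraph V) (u v : V) : Prop :=
  ∃ w, IsP3 G u v w ∨ IsP3 G v u w

theorem IsP3Edge.symm {u v : V} (h : IsP3Edge G u v) : IsP3Edge G v u :=
  h.imp fun _ => Or.symm

variable (hf : ∀ c x z, IsP3 G c x z → F c x z) (hl : ∀ c x z, IsP3 G c x z → F x z c)
include hf hl

theorem linkedUpToSwap_centre {c x z : V} (h : IsP3 G c x z) :
    LinkedUpToSwap F (c, x) (c, z) :=
  LinkedUpToSwap.swap_left (.inl (linked_of_isP3 hf hl h).2.2)

theorem linkedUpToSwap_end {c x z : V} (h : IsP3 G c x z) : LinkedUpToSwap F (x, c) (x, z) :=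
  .inl (linked_of_isP3 hf hl h).1

/-- In a triangle `a b v` whose edge `v a` lies on an induced path, two edges are equivalent. -/
theorem IsP3Edge.triangle {v a b : V} (h : IsP3Edge G v a) (hvb : G.Adj v b) (hab : G.Adj a b) :
    LinkedUpToSwap F (v, a) (v, b) ∨ LinkedUpToSwap F (a, v) (a, b) := by
  have main : ∀ v a b w, IsP3 G v a w → G.Adj v b → G.Adj a b →
      LinkedUpToSwap F (v, a) (v, b) ∨ LinkedUpToSwap F (a, v) (a, b) := by
    intro v a b w h hvb hab
    have hwb : w ≠ b := by rintro rfl; exact h.2.2.1 hab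
    by_cases hbw : G.Adj b w
    · right
      have e1 := linkedUpToSwap_end hf hl h
      have e2 := linkedUpToSwap_end hf hl (c := b) ⟨hab.symm, hbw, h.2.2⟩
      exact e1.trans e2.symm
    · left
      have e1 := linkedUpToSwap_centre hf hl h
      have e2 := linkedUpToSwap_centre hf hl (c := v) (x := b) (z := w) ⟨hvb, h.2.1, hbw, hwb.symm⟩
      exact e1.trans e2.symm
  obtain ⟨w, h | h⟩ := h
  · exact main v a b w h hvb hab
  · exact (main a v b w h hab hvb).symm

/-- When `a` and `b` are adjacent, either one triangle comparison is already the claim, or both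
edges are equivalent to the side `a b`. -/
theorem IsP3Edge.linked {v a b : V} (ha : IsP3Edge G v a) (hb : IsP3Edge G v b)
    (hva : G.Adj v a) (hvb : G.Adj v b) : LinkedUpToSwap F (v, a) (v, b) := by
  by_cases hab : a = b
  · subst hab; exact .inl (.refl _)
  by_cases hab' : G.Adj a b
  · rcases ha.triangle hf hl hvb hab' with h1 | h1
    · exact h1
    rcases hb.triangle hf hl hva hab'.symm with h2 | h2
    · exact h2.symm
    · exact h1.swap_left.trans (h2.swap_left.trans (.inr (.refl _))).symm
  · exact linkedUpToSwap_centre hf hl ⟨hva, hvb, hab', hab⟩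

omit hf hl in
theorem IsP3Edge.adj {u v : V} (h : IsP3Edge G u v) : G.Adj u v := by
  obtain ⟨w, h | h⟩ := h
  · exact h.1
  · exact h.1.symm

/-- If `v v'` is not itself such an edge, `v` and `v'` are adjacent twins, and the path through `v`
can be rerouted through `v'`. -/
theorem IsP3Edge.exists_of_adj {v v' a : V} (h : IsP3Edge G v a) (hvv' : G.Adj v v') :
    ∃ a', IsP3Edge G v' a' ∧ LinkedUpToSwap F (v, a) (v', a') := by
  by_cases hP : IsP3Edge G v v'
  · exact ⟨v, hP.symm, (h.linked hf hl hP h.adj hP.adj).swap_right⟩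
  have twin : ∀ w, w ≠ v → w ≠ v' → (G.Adj v w ↔ G.Adj v' w) := by
    intro w hw hw'
    constructor
    · intro hvw
      by_contra hcon
      exact hP ⟨w, .inl ⟨hvv', hvw, hcon, hw'.symm⟩⟩
    · intro hvw
      by_contra hcon
      exact hP ⟨w, .inr ⟨hvv'.symm, hvw, hcon, hw.symm⟩⟩
  have hav : a ≠ v := h.adj.ne'
  have hav' : a ≠ v' := by rintro rfl; exact hP h
  have hv'a : G.Adj v' a := (twin a hav hav').1 h.adj
  obtain ⟨w, h | h⟩ := h
  · have hwv' : w ≠ v' := by rintro rfl; exact h.2.2.1 hv'a.symm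
    have h' : IsP3 G v' a w := ⟨hv'a, (twin w h.2.1.ne' hwv').1 h.2.1, h.2.2⟩
    refine ⟨a, ⟨w, .inl h'⟩, ?_⟩
    exact ((linkedUpToSwap_end hf hl h).trans (linkedUpToSwap_end hf hl h').symm).swap_left.swap_right
  · have hwv' : w ≠ v' := by rintro rfl; exact h.2.2.1 hvv'
    have h' : IsP3 G a v' w := ⟨hv'a.symm, h.2.1, fun hc => h.2.2.1
      ((twin w h.2.2.2.symm hwv').2 hc), hwv'.symm⟩
    refine ⟨a, ⟨w, .inr h'⟩, ?_⟩
    exact ((linkedUpToSwap_centre hf hl h).trans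
      (linkedUpToSwap_centre hf hl h').symm).swap_left.swap_right

theorem IsP3Edge.exists_of_reachable {v v' a : V} (h : IsP3Edge G v a) (hvv' : G.Reachable v v') :
    ∃ a', IsP3Edge G v' a' ∧ LinkedUpToSwap F (v, a) (v', a') := by
  obtain ⟨p⟩ := hvv'
  induction p generalizing a with
  | nil => exact ⟨a, h, .inl (.refl _)⟩
  | cons hadj _ ih =>
    obtain ⟨a₁, h1, e1⟩ := h.exists_of_adj hf hl hadj
    obtain ⟨a₂, h2, e2⟩ := ih h1
    exact ⟨a₂, h2, e1.trans e2⟩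

/-- Within a component all edges of induced paths are equivalent up to reversal. Choosing one class
per component gives an acyclic relation that places each centre between its ends. -/
theorem exists_avoids_first_last (hF : NoCircuit F) :
    ∃ L : LinearOrder V, Avoids L G (true, false, true) := by
  have hroot : ∀ K : G.ConnectedComponent, ∃ p : V × V, ∀ u v, IsP3Edge G u v →
      G.connectedComponentMk u = K → LinkedUpToSwap F p (u, v) := by
    intro K
    by_cases hK : ∃ u v, IsP3Edge G u v ∧ G.connectedComponentMk u = K
    · obtain ⟨u, v, h, rfl⟩ := hK
      refine ⟨(u, v), fun u' v' h' hu' => ?_⟩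
      obtain ⟨w, h1, e1⟩ := h.exists_of_reachable hf hl (SimpleGraph.ConnectedComponent.exact hu'.symm)
      exact e1.trans (h1.linked hf hl h' h1.adj h'.adj)
    · obtain ⟨w, rfl⟩ := K.exists_rep
      -- No edge of this component lies on an induced path, so any pair will do; `NoCircuit` also
      -- covers the class of a diagonal pair.
      exact ⟨(w, w), fun u v h hu => (hK ⟨u, v, h, hu⟩).elim⟩
  choose root hroot using hroot
  let r : V → V → Prop := fun x y => x ≠ y ∧ G.connectedComponentMk x = G.connectedComponentMk y ∧
    Linked F (root (G.connectedComponentMk x)) (x, y)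
  obtain ⟨L, hL⟩ := exists_linearOrder_of_acyclic r (by
    intro v hv
    have : ∀ y, TransGen r v y → G.connectedComponentMk v = G.connectedComponentMk y ∧
        TransGen (fun x y => x ≠ y ∧ Linked F (root (G.connectedComponentMk v)) (x, y)) v y := by
      intro y h
      induction h with
      | single h => exact ⟨h.2.1, .single ⟨h.1, h.2.2⟩⟩
      | tail _ h ih => exact ⟨ih.1.trans h.2.1, ih.2.tail ⟨h.1, ih.1 ▸ h.2.2⟩⟩
    exact hF _ _ (this v hv).2)
  have key : ∀ c x z, IsP3 G c x z → (L.lt x c ∧ L.lt c z) ∨ (L.lt z c ∧ L.lt c x) := by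
    intro c x z hP
    have hcx : G.connectedComponentMk c = G.connectedComponentMk x :=
      SimpleGraph.ConnectedComponent.sound hP.1.reachable
    have hcz : G.connectedComponentMk c = G.connectedComponentMk z :=
      SimpleGraph.ConnectedComponent.sound hP.2.1.reachable
    have e := (linked_of_isP3 hf hl hP).2.2
    have e' := (linked_of_isP3 hf hl hP.symm).2.2
    rcases hroot _ x c ⟨z, .inr hP⟩ hcx.symm with h | h
    · left
      exact ⟨hL _ _ ⟨hP.1.ne', hcx.symm, hcx ▸ h⟩, hL _ _ ⟨hP.2.1.ne, hcz, h.trans e⟩⟩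
    · right
      have h : Linked F (root (G.connectedComponentMk c)) (c, x) := h
      exact ⟨hL _ _ ⟨hP.2.1.ne', hcz.symm, hcz ▸ h.trans e'.symm⟩, hL _ _ ⟨hP.1.ne, hcx, h⟩⟩
  refine ⟨L, fun _ c x z hP h1 h2 => ?_, by simp, fun _ c x z hP h1 h2 => ?_⟩
  · rcases key c x z hP with h | h
    · exact lt_asymm h.1 h1
    · exact lt_asymm h.1 (h1.trans h2)
  · rcases key c x z hP with h | h
    · exact lt_asymm h.2 h2
    · exact lt_asymm h.2 (h1.trans h2)

end ProperInterval

/-! ### Chordal graphs -/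

section Chordal

/-- An edge of a path can be pushed one step backwards along the path. -/
theorem reach_of_isP3 (hf : ∀ c x z, IsP3 G c x z → F c x z) {a b c : V} (h : IsP3 G b a c) :
    Reach F (b, c) (a, b) :=
  (Reach.left (hf b c a h.symm)).trans (Reach.right (hf b a c h))

/-- Pushing an edge backwards all the way round makes the five cyclically oriented edges equivalent,
and they form a circuit. -/
theorem pentagonFree_of_first (hF : NoCircuit F) (hf : ∀ c x z, IsP3 G c x z → F c x z) :
    PentagonFree G := by
  intro a b c d e hab hbc hcd hde hea hac had hbd hbe hce
  have r1 := reach_of_isP3 hf (a := a) (b := b) (c := c) ⟨hab.symm, hbc, hac, by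
    rintro rfl; exact had hcd⟩
  have r2 := reach_of_isP3 hf (a := b) (b := c) (c := d) ⟨hbc.symm, hcd, hbd, by
    rintro rfl; exact had hab⟩
  have r3 := reach_of_isP3 hf (a := c) (b := d) (c := e) ⟨hcd.symm, hde, hce, by
    rintro rfl; exact hac hea.symm⟩
  have r4 := reach_of_isP3 hf (a := d) (b := e) (c := a) ⟨hde.symm, hea, fun h => had h.symm, by
    rintro rfl; exact hac hcd.symm⟩
  have r5 := reach_of_isP3 hf (a := e) (b := a) (c := b) ⟨hea.symm, hab, fun h => hbe h.symm, by
    rintro rfl; exact hce hbc.symm⟩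
  have l1 : Linked F (a, b) (e, a) := ⟨r5, r4.trans (r3.trans (r2.trans r1))⟩
  have l2 : Linked F (a, b) (d, e) := ⟨r5.trans r4, r3.trans (r2.trans r1)⟩
  have l3 : Linked F (a, b) (c, d) := ⟨r5.trans (r4.trans r3), r2.trans r1⟩
  have l4 : Linked F (a, b) (b, c) := ⟨r5.trans (r4.trans (r3.trans r2)), r1⟩
  exact hF (a, b) a (.head ⟨hab.ne, .refl _⟩ (.head ⟨hbc.ne, l4⟩ (.head ⟨hcd.ne, l3⟩
    (.head ⟨hde.ne, l2⟩ (.single ⟨hea.ne, l1⟩)))))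

theorem pentagonFree_of_last (hF : NoCircuit F) (hl : ∀ c x z, IsP3 G c x z → F x z c) :
    PentagonFree G :=
  pentagonFree_of_first hF.flip fun c x z hP => hl c z x hP.symm

/-- No induced path `f 0, …, f k` is closed up to a cycle by a vertex `v` adjacent exactly to its
ends. Only chords between vertices at distance two are excluded. -/
theorem no_cycle_of_first (hF : NoCircuit F) (hf : ∀ c x z, IsP3 G c x z → F c x z) (k : ℕ)
    (hk : 2 ≤ k) (f : ℕ → V) (v : V) (hadj : ∀ i < k, G.Adj (f i) (f (i + 1)))
    (hP : ∀ i, i + 2 ≤ k → IsP3 G (f (i + 1)) (f i) (f (i + 2)))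
    (h0 : IsP3 G (f 0) v (f 1)) (hlast : IsP3 G (f k) (f (k - 1)) v)
    (hv : IsP3 G v (f k) (f 0)) : False := by
  have back : ∀ j, ∀ i, i + j < k → Reach F (f (i + j), f (i + j + 1)) (f i, f (i + 1)) := by
    intro j
    induction j with
    | zero => exact fun i _ => .refl
    | succ j ih =>
      intro i hi
      exact (reach_of_isP3 hf (hP (i + j) (by omega))).trans (ih i (by omega))
  have r0 : Reach F (f 0, f 1) (v, f 0) := reach_of_isP3 hf h0
  have r1 : Reach F (v, f 0) (f k, v) := reach_of_isP3 hf hv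
  have r2 : Reach F (f k, v) (f (k - 1), f k) := reach_of_isP3 hf hlast
  have hlink : ∀ i < k, Linked F (v, f 0) (f i, f (i + 1)) := by
    intro i hi
    constructor
    · have := back (k - 1 - i) i (by omega)
      rw [show i + (k - 1 - i) = k - 1 by omega, show k - 1 + 1 = k by omega] at this
      exact r1.trans (r2.trans this)
    · have := back i 0 (by omega)
      rw [Nat.zero_add] at this
      exact this.trans r0
  have hpath : ∀ i ≤ k, TransGen (fun x y => x ≠ y ∧ Linked F (v, f 0) (x, y)) v (f i) := by
    intro i
    induction i with
    | zero => exact fun _ => .single ⟨h0.1.ne', .refl _⟩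
    | succ i ih =>
      intro hi
      exact (ih (by omega)).tail ⟨(hadj i hi).ne, hlink i hi⟩
  have hend : Linked F (v, f 0) (f k, v) := by
    refine ⟨r1, r2.trans ?_⟩
    have := (hlink (k - 1) (by omega)).2
    rwa [show k - 1 + 1 = k by omega] at this
  exact hF (v, f 0) v ((hpath k le_rfl).tail ⟨hv.1.ne', hend⟩)

/-- Two nonadjacent neighbours of `v` are not joined by a path whose inner vertices lie in a set
`C` of vertices that are not adjacent to `v`. -/
theorem not_reachable_of_first (hF : NoCircuit F) (hf : ∀ c x z, IsP3 G c x z → F c x z)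
    (H : SimpleGraph V) (hle : H ≤ G) {v s t : V} {C : Set V} (hvC : ∀ x ∈ C, ¬ G.Adj v x ∧ x ≠ v)
    (hH : ∀ x y, H.Adj x y ↔ G.Adj x y ∧ (x ∈ C ∨ x = s ∨ x = t) ∧ (y ∈ C ∨ y = s ∨ y = t))
    (hvs : G.Adj v s) (hvt : G.Adj v t) (hst : ¬ G.Adj s t) (hne : s ≠ t) :
    ¬ H.Reachable s t := by
  intro hreach
  -- A shortest walk has no chords and meets `s` and `t` only at its ends, so `v` closes it to a
  -- forbidden cycle.
  obtain ⟨p, hp⟩ := hreach.exists_walk_length_eq_dist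
  have hk : 2 ≤ p.length := by
    rw [hp]
    exact hreach.one_lt_dist_of_ne_of_not_adj hne fun h => hst (hle h)
  have hadj : ∀ i < p.length, H.Adj (p.getVert i) (p.getVert (i + 1)) :=
    fun i hi => p.adj_getVert_succ hi
  have hdist : ∀ i ≤ p.length, ∀ q : H.Walk (p.getVert i) t, p.length - i ≤ q.length := by
    intro i hi q
    have := SimpleGraph.dist_le ((p.take i).append q)
    rw [SimpleGraph.Walk.length_append, SimpleGraph.Walk.take_length, ← hp] at this
    omega
  have hfirst : ∀ i ≤ p.length, p.getVert i = t → i = p.length := by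
    intro i hi h
    have := hdist i hi (SimpleGraph.Walk.nil.copy h.symm rfl)
    simp at this
    omega
  have hstart : ∀ i ≤ p.length, p.getVert i = s → i = 0 := by
    intro i hi h
    have := SimpleGraph.dist_le ((p.drop i).copy h rfl)
    rw [SimpleGraph.Walk.length_copy, SimpleGraph.Walk.drop_length, ← hp] at this
    omega
  have hmem : ∀ i, 0 < i → i < p.length → p.getVert i ∈ C := by
    intro i h0 hi
    rcases ((hH _ _).1 (hadj i hi)).2.1 with h | h | h
    · exact h
    · have := hstart i hi.le h; omega
    · have := hfirst i hi.le h; omega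
  have hset : ∀ i ≤ p.length, p.getVert i ∈ C ∨ p.getVert i = s ∨ p.getVert i = t := by
    intro i hi
    rcases Nat.eq_zero_or_pos i with rfl | h0
    · exact .inr (.inl (by simp))
    rcases hi.eq_or_lt with rfl | h1
    · exact .inr (.inr (by simp))
    · exact .inl (hmem i h0 h1)
  have hP : ∀ i, i + 2 ≤ p.length →
      IsP3 G (p.getVert (i + 1)) (p.getVert i) (p.getVert (i + 2)) := by
    intro i hi
    refine ⟨(hle (hadj i (by omega))).symm, hle (hadj (i + 1) (by omega)), fun h => ?_, fun h => ?_⟩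
    · have h' : H.Adj (p.getVert i) (p.getVert (i + 2)) :=
        (hH _ _).2 ⟨h, hset i (by omega), hset (i + 2) hi⟩
      have := hdist i (by omega) (SimpleGraph.Walk.cons h' (p.drop (i + 2)))
      rw [SimpleGraph.Walk.length_cons, SimpleGraph.Walk.drop_length] at this
      omega
    · have := hdist i (by omega) ((p.drop (i + 2)).copy h.symm rfl)
      rw [SimpleGraph.Walk.length_copy, SimpleGraph.Walk.drop_length] at this
      omega
  have e0 : p.getVert 0 = s := by simp
  have ek : p.getVert p.length = t := by simp
  refine no_cycle_of_first hF hf p.length hk p.getVert v (fun i hi => hle (hadj i hi)) hP ?_ ?_ ?_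
  · have h1 := hvC _ (hmem 1 one_pos (by omega))
    have h2 := hle (hadj 0 (by omega))
    exact ⟨by rw [e0]; exact hvs.symm, h2, h1.1, h1.2.symm⟩
  · have h1 := hvC _ (hmem (p.length - 1) (by omega) (by omega))
    have h2 := hle (hadj (p.length - 1) (by omega))
    rw [show p.length - 1 + 1 = p.length by omega] at h2
    exact ⟨h2.symm, by rw [ek]; exact hvt.symm, fun h => h1.1 h.symm, h1.2⟩
  · rw [e0, ek]
    exact ⟨hvt, hvs, fun h => hst h.symm, hne.symm⟩

/-- A vertex of a set `W` with a nonneighbour in `W` has a nonneighbour in `W` that is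
simplicial in `W`. -/
theorem exists_simplicial [Finite V] (hF : NoCircuit F) (hf : ∀ c x z, IsP3 G c x z → F c x z)
    (W : Set V) {v u : V} (hv : v ∈ W) (hu : u ∈ W) (huv : u ≠ v) (hvu : ¬ G.Adj v u) :
    ∃ t ∈ W, t ≠ v ∧ ¬ G.Adj v t ∧ ∀ x ∈ W, ∀ z ∈ W, ¬ IsP3 G t x z := by
  induction hn : W.ncard using Nat.strong_induction_on generalizing W v u with
  | _ n ih =>
  -- Dirac's argument: `C` is the component of `u` among the vertices of `W` that are neither `v`
  -- nor adjacent to `v`, and `S` consists of the neighbours of `v` attached to `C`. The set `S` is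
  -- a clique, and `C ∪ S` omits `v`, so induction applies to it.
  let r : V → V → Prop := fun x y => G.Adj x y ∧ y ∈ W ∧ y ≠ v ∧ ¬ G.Adj v y
  let C : Set V := {x | ReflTransGen r u x}
  have hC : ∀ x ∈ C, x ∈ W ∧ x ≠ v ∧ ¬ G.Adj v x := by
    intro x hx
    rcases ReflTransGen.cases_tail hx with h | ⟨y, -, h⟩
    · subst h; exact ⟨hu, huv, hvu⟩
    · exact h.2
  let S : Set V := {s | s ∈ W ∧ G.Adj v s ∧ ∃ x ∈ C, G.Adj x s}
  have hclique : ∀ s ∈ S, ∀ t ∈ S, s ≠ t → G.Adj s t := by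
    intro s hs t ht hne
    by_contra hst
    let H : SimpleGraph V :=
      { Adj := fun x y => G.Adj x y ∧ (x ∈ C ∨ x = s ∨ x = t) ∧ (y ∈ C ∨ y = s ∨ y = t)
        symm := ⟨fun x y h => ⟨h.1.symm, h.2.2, h.2.1⟩⟩
        loopless := ⟨fun x h => h.1.ne rfl⟩ }
    have hreachC : ∀ x ∈ C, H.Reachable u x := by
      intro x hx
      induction hx with
      | refl => exact .refl _
      | @tail y z hy hyz ih =>
        refine ih.trans (SimpleGraph.Adj.reachable ?_)
        exact ⟨hyz.1, .inl hy, .inl (ReflTransGen.tail hy hyz)⟩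
    obtain ⟨x, hx, hxs⟩ := hs.2.2
    obtain ⟨y, hy, hyt⟩ := ht.2.2
    have h1 : H.Adj x s := ⟨hxs, .inl hx, .inr (.inl rfl)⟩
    have h2 : H.Adj y t := ⟨hyt, .inl hy, .inr (.inr rfl)⟩
    exact not_reachable_of_first hF hf H (fun x y h => h.1) (fun x hx => ⟨(hC x hx).2.2, (hC x hx).2.1⟩)
      (fun x y => Iff.rfl) hs.2.1 ht.2.1 hst hne
      (h1.reachable.symm.trans ((hreachC x hx).symm.trans ((hreachC y hy).trans h2.reachable)))
  have hlt : (C ∪ S).ncard < n := by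
    rw [← hn]
    refine Set.ncard_lt_ncard ⟨?_, fun hs => ?_⟩ (Set.toFinite _)
    · rintro x (hx | hx)
      · exact (hC x hx).1
      · exact hx.1
    · rcases hs hv with h | h
      · exact (hC v h).2.1 rfl
      · exact h.2.1.ne rfl
  -- Induction is based at a vertex of `S` with a nonneighbour; the vertex found avoids the clique
  -- `S`. Failing that, `S` is joined to everything and a base vertex in `C` works. Failing both, `C
  -- ∪ S` is a clique.
  have hmain : ∃ t ∈ C, ∀ x ∈ C ∪ S, ∀ z ∈ C ∪ S, ¬ IsP3 G t x z := by
    by_cases hS : ∃ s ∈ S, ∃ w ∈ C ∪ S, w ≠ s ∧ ¬ G.Adj s w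
    · obtain ⟨s, hs, w, hw, hws, hsw⟩ := hS
      obtain ⟨t, ht, hts, hst, hsimp⟩ := ih _ hlt (C ∪ S) (.inr hs) hw hws hsw rfl
      exact ⟨t, ht.resolve_right fun h => hst (hclique s hs t h hts.symm), hsimp⟩
    push Not at hS
    by_cases hCC : ∃ x ∈ C, ∃ w ∈ C ∪ S, w ≠ x ∧ ¬ G.Adj x w
    · obtain ⟨x, hx, w, hw, hwx, hxw⟩ := hCC
      obtain ⟨t, ht, htx, hxt, hsimp⟩ := ih _ hlt (C ∪ S) (.inl hx) hw hwx hxw rfl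
      exact ⟨t, ht.resolve_right fun h => hxt (hS t h x (.inl hx) htx.symm).symm, hsimp⟩
    push Not at hCC
    refine ⟨u, ReflTransGen.refl, fun x hx z hz hP => hP.2.2.1 ?_⟩
    rcases hx with hx | hx
    · exact hCC x hx z hz hP.2.2.2.symm
    · exact hS x hx z hz hP.2.2.2.symm
  obtain ⟨t, ht, hsimp⟩ := hmain
  have hnbr : ∀ x ∈ W, G.Adj t x → x ∈ C ∪ S := by
    intro x hx htx
    by_cases hvx : G.Adj v x
    · exact .inr ⟨hx, hvx, t, ht, htx⟩
    · refine .inl (ReflTransGen.tail ht ⟨htx, hx, ?_, hvx⟩)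
      rintro rfl
      exact (hC t ht).2.2 htx.symm
  exact ⟨t, (hC t ht).1, (hC t ht).2.1, (hC t ht).2.2,
    fun x hx z hz hP => hsimp x (hnbr x hx hP.1) z (hnbr z hz hP.2.1) hP⟩

theorem exists_avoids_first [Finite V] (hF : NoCircuit F)
    (hf : ∀ c x z, IsP3 G c x z → F c x z) :
    ∃ L : LinearOrder V, Avoids L G (true, false, false) := by
  obtain ⟨L, hL⟩ := exists_linearOrder_of_elimination
    (fun W s => ∀ x ∈ W, ∀ z ∈ W, ¬ IsP3 G s x z) (by
      intro W ⟨v, hv⟩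
      by_cases h : ∃ u ∈ W, u ≠ v ∧ ¬ G.Adj v u
      · obtain ⟨u, hu, huv, hvu⟩ := h
        obtain ⟨t, ht, -, -, h⟩ := exists_simplicial hF hf W hv hu huv hvu
        exact ⟨t, ht, h⟩
      by_cases hP : ∃ x ∈ W, ∃ z ∈ W, IsP3 G v x z
      · obtain ⟨x, hx, z, hz, hP⟩ := hP
        obtain ⟨t, ht, -, -, h⟩ := exists_simplicial hF hf W hx hz hP.2.2.2.symm hP.2.2.1
        exact ⟨t, ht, h⟩
      · push Not at hP
        exact ⟨v, hv, hP⟩)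
  refine ⟨L, fun _ c x z hP h1 h2 => ?_, by simp, by simp⟩
  obtain ⟨W, hW, hx⟩ := hL c
  exact hW x (hx x h1.le) z (hx z (h1.trans h2).le) hP

end Chordal

end ProperIntervalAndChordal

/-! ### Case analysis over the forbidden positions of centres -/

section Combination

variable {V : Type*}

theorem exists_linearOrder_true : ∃ _ : LinearOrder V, True :=
  (exists_linearOrder_of_key (fun _ : V => (0 : ℕ))).imp fun _ _ => trivial

/-- Flags for the centre of an induced path being the first, the middle, or the last vertex. -/
abbrev Positions : Type := Bool × Bool × Bool

/-- The flags after reversal of the order. -/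
def Positions.reverse (s : Positions) : Positions := (s.2.2, s.2.1, s.1)

theorem Avoids.mono {L : LinearOrder V} {G : SimpleGraph V} {s t : Positions} (h : Avoids L G t)
    (hst : s ≤ t) : Avoids L G s :=
  ⟨fun hs => h.first (hst.1 hs), fun hs => h.mid (hst.2.1 hs), fun hs => h.last (hst.2.2 hs)⟩

theorem Forces.mono {F : V → V → V → Prop} {G : SimpleGraph V} {s t : Positions}
    (h : Forces F G t) (hst : s ≤ t) : Forces F G s :=
  ⟨fun hs => h.first (hst.1 hs), fun hs => h.mid (hst.2.1 hs), fun hs => h.last (hst.2.2 hs)⟩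

theorem Avoids.empty {L : LinearOrder V} {G : SimpleGraph V} : Avoids L G (false, false, false) :=
  ⟨by simp, by simp, by simp⟩

theorem Forces.reverse {F : V → V → V → Prop} {G : SimpleGraph V} {s : Positions}
    (h : Forces F G s.reverse) : Forces (fun x y z => F z y x) G s :=
  ⟨fun hs c x z hP => h.last hs c z x hP.symm, fun hs c x z hP => h.mid hs c z x hP.symm,
    fun hs c x z hP => h.first hs c z x hP.symm⟩

theorem exists_reversed_linearOrder (L : LinearOrder V) :
    ∃ L' : LinearOrder V, ∀ x y, L'.lt x y ↔ L.lt y x :=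
  ⟨inferInstanceAs (LinearOrder Vᵒᵈ), fun _ _ => Iff.rfl⟩

theorem Avoids.reverse {L L' : LinearOrder V} {G : SimpleGraph V} {s : Positions}
    (h : Avoids L G s) (hL : ∀ x y, L'.lt x y ↔ L.lt y x) : Avoids L' G s.reverse :=
  ⟨fun hs c x z hP h1 h2 => h.last hs c z x hP.symm ((hL _ _).1 h2) ((hL _ _).1 h1),
    fun hs c x z hP h1 h2 => h.mid hs c z x hP.symm ((hL _ _).1 h2) ((hL _ _).1 h1),
    fun hs c x z hP h1 h2 => h.first hs c z x hP.symm ((hL _ _).1 h2) ((hL _ _).1 h1)⟩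

/-- If the constraint digraph that contains the constraints selected by `a` for the complement and
by `b` for the graph has no circuit, then there is an order that satisfies the constraints
selected by `a'` for the complement and by `b'` for the graph. -/
def Solvable (V : Type*) (a b a' b' : Positions) : Prop :=
  ∀ (G : SimpleGraph V) (F : V → V → V → Prop), NoCircuit F → Forces F Gᶜ a → Forces F G b →
    ∃ L : LinearOrder V, Avoids L Gᶜ a' ∧ Avoids L G b'

namespace Solvable

variable {a b a' b' c d : Positions}

theorem compl (h : Solvable V a b a' b') : Solvable V b a b' a' := by
  intro G F hF ha hb
  obtain ⟨L, h1, h2⟩ := h Gᶜ F hF (by rwa [compl_compl]) ha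
  exact ⟨L, h2, by rwa [compl_compl] at h1⟩

theorem reverse (h : Solvable V a b a' b') :
    Solvable V a.reverse b.reverse a'.reverse b'.reverse := by
  intro G F hF ha hb
  obtain ⟨L, h1, h2⟩ := h G _ hF.flip ha.reverse hb.reverse
  obtain ⟨L', hL'⟩ := exists_reversed_linearOrder L
  exact ⟨L', h1.reverse hL', h2.reverse hL'⟩

/-- As the order found may avoid more than was forced, one base case covers all flags in an
interval. -/
theorem mono (h : Solvable V a b a' b') (hc : a ≤ c ∧ c ≤ a' ∧ b ≤ d ∧ d ≤ b') :
    Solvable V c d c d := by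
  intro G F hF ha hb
  obtain ⟨L, h1, h2⟩ := h G F hF (ha.mono hc.1) (hb.mono hc.2.2.1)
  exact ⟨L, h1.mono hc.2.1, h2.mono hc.2.2.2⟩

/-- The use of a solved case up to complementation, reversal and monotonicity. -/
theorem of_symm (h : Solvable V a b a' b')
    (hc : (a ≤ c ∧ c ≤ a' ∧ b ≤ d ∧ d ≤ b') ∨ (b ≤ c ∧ c ≤ b' ∧ a ≤ d ∧ d ≤ a') ∨
      (a.reverse ≤ c ∧ c ≤ a'.reverse ∧ b.reverse ≤ d ∧ d ≤ b'.reverse) ∨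
      (b.reverse ≤ c ∧ c ≤ b'.reverse ∧ a.reverse ≤ d ∧ d ≤ a'.reverse)) :
    Solvable V c d c d := by
  rcases hc with hc | hc | hc | hc
  · exact h.mono hc
  · exact h.compl.mono hc
  · exact h.reverse.mono hc
  · exact h.compl.reverse.mono hc

/-- If all three positions are forbidden, then there are no constrained triples at all. -/
theorem of_none (h : Solvable V (false, false, false) b (false, false, false) b) :
    Solvable V (true, true, true) b (true, true, true) b := by
  intro G F hF ha hb
  obtain ⟨L, -, hL⟩ := h G F hF ⟨by simp, by simp, by simp⟩ hb
  have hno := not_isP3_of_all hF (ha.first rfl) (ha.mid rfl) (ha.last rfl)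
  exact ⟨L, ⟨fun _ c x z hP => (hno c x z hP).elim, fun _ c x z hP => (hno c x z hP).elim,
    fun _ c x z hP => (hno c x z hP).elim⟩, hL⟩

theorem none_none : Solvable V (false, false, false) (false, false, false) (false, false, false)
    (false, false, false) := fun _ _ _ _ _ =>
  exists_linearOrder_true.imp fun _ _ => ⟨.empty, .empty⟩

theorem none_first_last : Solvable V (false, false, false) (true, false, true)
    (false, false, false) (true, false, true) := fun _ _ hF _ hb =>
  (exists_avoids_first_last (hb.first rfl) (hb.last rfl) hF).imp fun _ h => ⟨.empty, h⟩

variable [Finite V]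

theorem none_first : Solvable V (false, false, false) (true, false, false) (false, false, false)
    (true, false, false) := fun _ _ hF _ hb =>
  (exists_avoids_first hF (hb.first rfl)).imp fun _ h => ⟨.empty, h⟩

theorem none_mid : Solvable V (false, false, false) (false, true, false) (false, false, false)
    (false, true, false) := by
  intro G F hF _ hb
  obtain ⟨D, hD⟩ := exists_isTransitiveOrientation hF (hb.mid rfl)
  exact hD.exists_avoids_mid.imp fun _ h => ⟨.empty, h⟩

theorem none_mid_last : Solvable V (false, false, false) (false, true, true)
    (false, false, false) (false, true, true) := fun _ _ hF _ hb =>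
  (exists_avoids_mid_last (nestedNeighborhoods_of_mid_of_last hF (hb.mid rfl) (hb.last rfl))).imp
    fun _ h => ⟨.empty, h⟩

theorem last_last : Solvable V (false, false, true) (false, false, true) (false, true, true)
    (false, true, true) := fun _ _ hF ha hb =>
  (alternatingFree_of_first_of_first hF.flip (fun c x z h => ha.last rfl c z x h.symm)
    (fun c x z h => hb.last rfl c z x h.symm)).exists_avoids_mid_last

theorem first_last : Solvable V (true, false, false) (false, false, true) (true, false, false)
    (false, false, true) := fun _ _ hF ha hb =>
  exists_avoids_split (squareFree_of_last hF (hb.last rfl))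
    (squareFree_of_first hF (ha.first rfl)) (pentagonFree_of_last hF (hb.last rfl))

theorem first_mid_last : Solvable V (true, false, false) (false, true, true) (true, true, false)
    (false, true, true) := by
  intro G F hF ha hb
  have h := nestedNeighborhoods_of_mid_of_last hF (hb.mid rfl) (hb.last rfl)
  exact (alternatingFree_of h.squareFree (squareFree_of_first hF (ha.first rfl))
    h.pathFree).exists_avoids_first_mid_and_mid_last

theorem first_first_last : Solvable V (true, false, false) (true, false, true)
    (true, true, false) (true, false, true) := fun _ _ hF ha hb =>
  (alternatingFree_of_first_of_first hF (ha.first rfl) (hb.first rfl)).exists_avoids_of_clawFree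
    (clawFree_of_first_of_last hF (hb.first rfl) (hb.last rfl))

theorem mid_mid : Solvable V (false, true, false) (false, true, false) (false, true, false)
    (false, true, false) := by
  intro G F hF ha hb
  obtain ⟨D, hD⟩ := exists_isTransitiveOrientation hF (hb.mid rfl)
  obtain ⟨D', hD'⟩ := exists_isTransitiveOrientation hF (ha.mid rfl)
  exact hD.exists_avoids_mid_and_mid hD'

theorem mid_last : Solvable V (false, true, false) (false, false, true) (false, true, false)
    (false, false, true) := by
  intro G F hF ha hb
  obtain ⟨D, hD⟩ := exists_isTransitiveOrientation hF (ha.mid rfl)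
  exact hD.exists_avoids_interval (squareFree_of_last hF (hb.last rfl))

theorem mid_mid_last : Solvable V (false, true, false) (false, true, true) (false, true, false)
    (false, true, true) := by
  intro G F hF ha hb
  obtain ⟨D, hD⟩ := exists_isTransitiveOrientation hF (ha.mid rfl)
  exact hD.exists_avoids_nested (nestedNeighborhoods_of_mid_of_last hF (hb.mid rfl) (hb.last rfl))

theorem mid_first_last : Solvable V (false, true, false) (true, false, true) (false, true, false)
    (true, false, true) := by
  intro G F hF ha hb
  obtain ⟨D, hD⟩ := exists_isTransitiveOrientation hF (ha.mid rfl)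
  exact hD.exists_avoids_semiorder (squareFree_of_first hF (hb.first rfl))
    (clawFree_of_first_of_last hF (hb.first rfl) (hb.last rfl))

theorem first_last_first_last : Solvable V (true, false, true) (true, false, true)
    (true, false, true) (true, false, true) := fun _ _ hF ha hb =>
  exists_avoids_first_last_of_all hF (ha.first rfl) (ha.last rfl) (hb.first rfl) (hb.last rfl)

theorem of_ne_all (ha : a ≠ (true, true, true)) (hb : b ≠ (true, true, true)) :
    Solvable V a b a b := by
  obtain ⟨a₁, a₂, a₃⟩ := a
  obtain ⟨b₁, b₂, b₃⟩ := b
  cases a₁ <;> cases a₂ <;> cases a₃ <;> first | exact (ha rfl).elim | skip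
  all_goals
    cases b₁ <;> cases b₂ <;> cases b₃ <;> first
      | exact (hb rfl).elim
      | exact none_none
      | exact none_first.of_symm (by decide)
      | exact none_mid.of_symm (by decide)
      | exact none_mid_last.of_symm (by decide)
      | exact none_first_last.of_symm (by decide)
      | exact last_last.of_symm (by decide)
      | exact first_last.of_symm (by decide)
      | exact first_mid_last.of_symm (by decide)
      | exact first_first_last.of_symm (by decide)
      | exact mid_mid.of_symm (by decide)
      | exact mid_last.of_symm (by decide)
      | exact mid_mid_last.of_symm (by decide)
      | exact mid_first_last.of_symm (by decide)
      | exact first_last_first_last.of_symm (by decide)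

theorem all (a b : Positions) : Solvable V a b a b := by
  have hb : ∀ b : Positions, Solvable V (false, false, false) b (false, false, false) b := by
    intro b
    by_cases hb : b = (true, true, true)
    · subst hb
      exact (of_none none_none).compl
    · exact of_ne_all (by decide) hb
  by_cases ha : a = (true, true, true)
  · subst ha
    exact of_none (hb b)
  by_cases hb' : b = (true, true, true)
  · subst hb'
    exact (of_none (hb a)).compl
  · exact of_ne_all ha hb'

end Solvable

end Combination

/-! ### Translation to the constraint digraph -/

section ConstraintDigraph

variable {V : Type*} {H : SimpleGraph V} {𝓕 : Set (Pattern 3)}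

/-- The ordered triples that induce a pattern in `𝓕`. -/
def Forbidden (H : SimpleGraph V) (𝓕 : Set (Pattern 3)) (x y z : V) : Prop :=
  ∃ P ∈ 𝓕, Induces H P ![x, y, z]

theorem Forbidden.ne {x y z : V} (h : Forbidden H 𝓕 x y z) : x ≠ y ∧ y ≠ z ∧ x ≠ z := by
  obtain ⟨P, -, hinj, -⟩ := h
  refine ⟨fun h => ?_, fun h => ?_, fun h => ?_⟩
  · exact absurd (@hinj 0 1 (by simpa using h)) (by decide)
  · exact absurd (@hinj 1 2 (by simpa using h)) (by decide)
  · exact absurd (@hinj 0 2 (by simpa using h)) (by decide)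

theorem Forbidden.congr {x y z x' y' z' : V} (h : Forbidden H 𝓕 x y z) (hxy' : x' ≠ y')
    (hyz' : y' ≠ z') (hxz' : x' ≠ z') (hxy : H.Adj x y ↔ H.Adj x' y')
    (hyz : H.Adj y z ↔ H.Adj y' z') (hxz : H.Adj x z ↔ H.Adj x' z') : Forbidden H 𝓕 x' y' z' := by
  obtain ⟨P, hP, hinj, hind⟩ := h
  refine ⟨P, hP, ?_, ?_⟩
  · intro i j hij
    fin_cases i <;> fin_cases j <;>
      first
      | rfl
      | exact (hxy' hij).elim
      | exact (hxy' hij.symm).elim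
      | exact (hyz' hij).elim
      | exact (hyz' hij.symm).elim
      | exact (hxz' hij).elim
      | exact (hxz' hij.symm).elim
  · intro i j
    rw [← hind i j]
    have hswap : ∀ {a b a' b' : V}, (H.Adj a b ↔ H.Adj a' b') → (H.Adj b' a' ↔ H.Adj b a) :=
      fun h => (H.adj_comm _ _).trans (h.symm.trans (H.adj_comm _ _))
    fin_cases i <;> fin_cases j <;> first
      | exact iff_of_false H.irrefl H.irrefl
      | exact hxy.symm
      | exact hyz.symm
      | exact hxz.symm
      | exact hswap hxy
      | exact hswap hyz
      | exact hswap hxz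

theorem NoCircuit.false_of_permutations {F : V → V → V → Prop} (hF : NoCircuit F) {x y z : V}
    (hxy : x ≠ y) (h1 : F x y z) (h2 : F x z y) (h3 : F z x y) (h4 : F y x z) (h5 : F y z x)
    (h6 : F z y x) : False :=
  hF.not_linked_swap hxy
    ⟨(Reach.left h1).trans ((Reach.right h2).trans (Reach.left h3)),
      (Reach.left h4).trans ((Reach.right h5).trans (Reach.left h6))⟩

/-- The flags record the positions in which the centre of some induced path is forbidden; as only
adjacencies matter, one such path forbids all of them in that position. -/
theorem exists_isFreeOrdering_of_noCircuit [Finite V] (hF : NoCircuit (Forbidden H 𝓕)) :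
    ∃ L : LinearOrder V, IsFreeOrdering H 𝓕 L := by
  classical
  let flags : SimpleGraph V → Positions := fun G =>
    (decide (∃ c x z, IsP3 G c x z ∧ Forbidden H 𝓕 c x z),
      decide (∃ c x z, IsP3 G c x z ∧ Forbidden H 𝓕 x c z),
      decide (∃ c x z, IsP3 G c x z ∧ Forbidden H 𝓕 x z c))
  have hforces : ∀ G : SimpleGraph V, (∀ {c x z c' x' z'}, IsP3 G c x z → IsP3 G c' x' z' →
      (H.Adj c x ↔ H.Adj c' x') ∧ (H.Adj c z ↔ H.Adj c' z') ∧ (H.Adj x z ↔ H.Adj x' z')) →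
      Forces (Forbidden H 𝓕) G (flags G) := by
    intro G hG
    refine ⟨fun hs c x z hP => ?_, fun hs c x z hP => ?_, fun hs c x z hP => ?_⟩
    all_goals
      obtain ⟨c', x', z', hP', h⟩ := of_decide_eq_true hs
      obtain ⟨e1, e2, e3⟩ := hG hP' hP
    · exact h.congr hP.1.ne hP.2.2.2 hP.2.1.ne e1 e3 e2
    · exact h.congr hP.1.ne' hP.2.1.ne hP.2.2.2
        (by rwa [H.adj_comm x' c', H.adj_comm x c]) e2 e3
    · exact h.congr hP.2.2.2 hP.2.1.ne' hP.1.ne' e3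
        (by rwa [H.adj_comm z' c', H.adj_comm z c]) (by rwa [H.adj_comm x' c', H.adj_comm x c])
  obtain ⟨L, hA, hB⟩ := Solvable.all (V := V) (flags Hᶜ) (flags H) H _ hF
    (hforces Hᶜ (by
      intro c x z c' x' z' h h'
      obtain ⟨h1, h2, h3, -⟩ := isP3_compl_iff.1 h
      obtain ⟨h4, h5, h6, -⟩ := isP3_compl_iff.1 h'
      simp only [h1, h2, h3, h4, h5, h6, and_self]))
    (hforces H fun h h' => by
      simp only [h.1, h.2.1, h.2.2.1, h'.1, h'.2.1, h'.2.2.1, and_self])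
  refine ⟨L, fun P hP ⟨v, hv, hind⟩ => ?_⟩
  have h01 := hv 0 1 (by decide)
  have h12 := hv 1 2 (by decide)
  have hforb : Forbidden H 𝓕 (v 0) (v 1) (v 2) := by
    have : ![v 0, v 1, v 2] = v := by
      ext i; fin_cases i <;> rfl
    exact ⟨P, hP, this ▸ hind⟩
  generalize v 0 = x at *
  generalize v 1 = y at *
  generalize v 2 = z at *
  obtain ⟨hxy, hyz, hxz⟩ := hforb.ne
  by_cases a1 : H.Adj x y <;> by_cases a2 : H.Adj y z <;> by_cases a3 : H.Adj x z
  · have b1 := a1.symm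
    have b2 := a2.symm
    have b3 := a3.symm
    refine hF.false_of_permutations hxy hforb ?_ ?_ ?_ ?_ ?_ <;>
      exact hforb.congr (by tauto) (by tauto) (by tauto) (by tauto) (by tauto) (by tauto)
  · have hP3 : IsP3 H y x z := ⟨a1.symm, a2, a3, hxz⟩
    exact hB.mid (decide_eq_true ⟨_, _, _, hP3, hforb⟩) _ _ _ hP3 h01 h12
  · have hP3 : IsP3 H x y z := ⟨a1, a3, a2, hyz⟩
    exact hB.first (decide_eq_true ⟨_, _, _, hP3, hforb⟩) _ _ _ hP3 h01 h12
  · have hP3 : IsP3 Hᶜ z x y := isP3_compl_iff.2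
      ⟨fun h => a3 h.symm, fun h => a2 h.symm, a1, hxz.symm, hyz.symm⟩
    exact hA.last (decide_eq_true ⟨_, _, _, hP3, hforb⟩) _ _ _ hP3 h01 h12
  · have hP3 : IsP3 H z x y := ⟨a3.symm, a2.symm, a1, hxy⟩
    exact hB.last (decide_eq_true ⟨_, _, _, hP3, hforb⟩) _ _ _ hP3 h01 h12
  · have hP3 : IsP3 Hᶜ x y z := isP3_compl_iff.2 ⟨a1, a3, a2, hxy, hxz⟩
    exact hA.first (decide_eq_true ⟨_, _, _, hP3, hforb⟩) _ _ _ hP3 h01 h12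
  · have hP3 : IsP3 Hᶜ y x z := isP3_compl_iff.2 ⟨fun h => a1 h.symm, a2, a3, hxy.symm, hyz⟩
    exact hA.mid (decide_eq_true ⟨_, _, _, hP3, hforb⟩) _ _ _ hP3 h01 h12
  · have b1 : ¬ H.Adj y x := fun h => a1 h.symm
    have b2 : ¬ H.Adj z y := fun h => a2 h.symm
    have b3 : ¬ H.Adj z x := fun h => a3 h.symm
    refine hF.false_of_permutations hxy hforb ?_ ?_ ?_ ?_ ?_ <;>
      exact hforb.congr (by tauto) (by tauto) (by tauto) (by tauto) (by tauto) (by tauto)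

theorem exists_closed_walk_of_transGen {r : V → V → Prop} {a b : V} (h : TransGen r a b) :
    ∃ (n : ℕ) (f : ℕ → V), f 0 = a ∧ f (n + 1) = b ∧ ∀ i ≤ n, r (f i) (f (i + 1)) := by
  induction h with
  | @single b h =>
    exact ⟨0, fun i => if i = 0 then a else b, by simp, by simp, by simpa using h⟩
  | @tail b c _ h ih =>
    obtain ⟨n, f, h0, hn, hf⟩ := ih
    refine ⟨n + 1, fun i => if i ≤ n + 1 then f i else c, by simpa using h0, by simp, ?_⟩
    intro i hi
    by_cases hin : i ≤ n
    · simpa [hi, show i + 1 ≤ n + 1 by omega] using hf i hin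
    · have : i = n + 1 := by omega
      subst this
      simpa [hn] using h

/-- Forbidden triples have distinct entries, so arcs never touch the diagonal and walks lift to
distinct pairs. -/
theorem reachable_of_reach {p q : DistinctPair V} (h : Reach (Forbidden H 𝓕) p.1 q.1) :
    Reachable (constraintDigraph H 𝓕) p q := by
  obtain ⟨q, hq⟩ := q
  change Reach _ p.1 q at h
  induction h with
  | refl => exact .refl
  | @tail b c _ h ih =>
    obtain ⟨x, y, z, hF, h⟩ := h
    have hb : b.1 ≠ b.2 := by
      rcases h with ⟨rfl, -⟩ | ⟨rfl, -⟩
      · exact hF.ne.1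
      · exact hF.ne.2.1
    exact (ih hb).tail ⟨x, y, z, hF, h⟩

theorem noCircuit_of_forall_not_hasCircuit
    (h : ∀ S : Set (DistinctPair V), IsStrongComponent (constraintDigraph H 𝓕) S →
      ¬ HasCircuit S) : NoCircuit (Forbidden H 𝓕) := by
  intro p v hv
  obtain ⟨n, f, h0, hn, hf⟩ := exists_closed_walk_of_transGen hv
  -- The pair `p` is either the first pair of the closed walk or the head of an arc.
  have hp : p.1 ≠ p.2 := by
    obtain ⟨hne, -, hr⟩ := hf 0 (Nat.zero_le n)
    rcases ReflTransGen.cases_tail hr with h | ⟨_, -, x, y, z, hF, ⟨-, rfl⟩ | ⟨-, rfl⟩⟩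
    · subst h; exact hne
    · exact hF.ne.2.1.symm
    · exact hF.ne.1.symm
  have hn1 : 1 ≤ n := by
    rcases Nat.eq_zero_or_pos n with rfl | h
    · exact ((hf 0 le_rfl).1 (h0.trans hn.symm)).elim
    · exact h
  refine h {b | Reachable (constraintDigraph H 𝓕) ⟨p, hp⟩ b ∧
    Reachable (constraintDigraph H 𝓕) b ⟨p, hp⟩} ⟨_, rfl⟩ ⟨n, hn1, fun i => f i, fun i => ?_⟩
  have hi : f (i + 1 : Fin (n + 1)) = f (i + 1) := by
    by_cases hlast : i = Fin.last n
    · subst hlast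
      simp [h0, hn]
    · rw [Fin.val_add_one_of_lt (Fin.lt_last_iff_ne_last.2 hlast)]
  obtain ⟨hne, h1, h2⟩ := hf i (Nat.lt_succ_iff.1 i.2)
  refine ⟨by simpa only [hi] using hne, reachable_of_reach ?_, reachable_of_reach ?_⟩
  · simpa only [hi] using h1
  · simpa only [hi] using h2

/-- For a forbidden triple, `x < y` and `y < z` cannot both hold, so either inequality reverses the
other. -/
theorem IsFreeOrdering.lt_of_reachable {L : LinearOrder V} (hL : IsFreeOrdering H 𝓕 L)
    {p q : DistinctPair V} (h : Reachable (constraintDigraph H 𝓕) p q)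
    (hp : L.lt p.1.1 p.1.2) : L.lt q.1.1 q.1.2 := by
  have hfree : ∀ x y z, Forbidden H 𝓕 x y z → L.lt x y → ¬ L.lt y z := by
    rintro x y z ⟨P, hP, hind⟩ hxy hyz
    refine hL P hP ⟨![x, y, z], fun i j hij => ?_, hind⟩
    fin_cases i <;> fin_cases j <;> simp at hij ⊢
    · exact hxy
    · exact hxy.trans hyz
    · exact hyz
  induction h with
  | refl => exact hp
  | tail _ h ih =>
    obtain ⟨x, y, z, hF, h⟩ := h
    have hF : Forbidden H 𝓕 x y z := hF
    obtain ⟨h1, h2⟩ | ⟨h1, h2⟩ := h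
    · rw [h1] at ih
      rw [h2]
      exact (lt_trichotomy z y).resolve_right fun h => h.elim (hF.ne.2.1.symm ·)
        (hfree x y z hF ih)
    · rw [h1] at ih
      rw [h2]
      exact (lt_trichotomy y x).resolve_right fun h => h.elim (hF.ne.1.symm ·)
        fun h => hfree x y z hF h ih

theorem not_forall_lt_add_one {n : ℕ} (L : LinearOrder V) (x : Fin (n + 1) → V) :
    ¬ ∀ i, L.lt (x i) (x (i + 1)) := by
  intro h
  obtain ⟨i, -, hi⟩ := Finset.exists_max_image Finset.univ x Finset.univ_nonempty
  exact not_lt_of_ge (hi (i + 1) (Finset.mem_univ _)) (h i)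

theorem IsFreeOrdering.not_hasCircuit {L : LinearOrder V} (hL : IsFreeOrdering H 𝓕 L)
    {S : Set (DistinctPair V)} (hS : IsStrongComponent (constraintDigraph H 𝓕) S) :
    ¬ HasCircuit S := by
  rintro ⟨n, -, x, hx⟩
  obtain ⟨a, rfl⟩ := hS
  choose hne hmem using hx
  by_cases ha : L.lt a.1.1 a.1.2
  · exact not_forall_lt_add_one L x fun i => hL.lt_of_reachable (hmem i).1 ha
  · have hgt : ∀ i, L.lt (x (i + 1)) (x i) := fun i =>
      (lt_trichotomy (x (i + 1)) (x i)).resolve_right fun h => h.elim (hne i).symm fun h =>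
        ha (hL.lt_of_reachable (hmem i).2 h)
    obtain ⟨L', hL'⟩ := exists_reversed_linearOrder L
    exact not_forall_lt_add_one L' x fun i => (hL' _ _).2 (hgt i)

end ConstraintDigraph

end OrderedPattern

theorem theorem1 {V : Type*} [Finite V] (H : SimpleGraph V)
    (𝓕 : Set (OrderedPattern.Pattern 3)) :
    (∃ L : LinearOrder V, OrderedPattern.IsFreeOrdering H 𝓕 L) ↔
      ∀ S : Set (OrderedPattern.DistinctPair V),
        OrderedPattern.IsStrongComponent (OrderedPattern.constraintDigraph H 𝓕) S →
          ¬ OrderedPattern.HasCircuit S :=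
  ⟨fun ⟨_, hL⟩ _ hS => hL.not_hasCircuit hS, fun h =>
    OrderedPattern.exists_isFreeOrdering_of_noCircuit
      (OrderedPattern.noCircuit_of_forall_not_hasCircuit h)⟩
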